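/- All objects are germs at the origin of $\mathbb{R}^2$ and of class $C^\infty$; $\mathcal{E}$ is the ring of smooth function germs at the origin. A non-zero function germ is one with non-zero value at the origin. Let $a_2^+=x\,dx+y\,dy$ and $X_{a_2^+}=-y\,\partial_x+x\,\partial_y$, which generates its kernel. A conformal symmetry of $a_2^+$ is a diffeomorphism germ $\phi:(\mathbb{R}^2,0)\to(\mathbb{R}^2,0)$ with $a_2^+=k\cdot\phi^*a_2^+$ for some non-zero function germ $k$. For vector fields, $X_1\sim X_2$ (orbital $a_2^+$-conjugacy) means $X_1=h\cdot\phi^*X_2$, where $(\phi^*X_2)(p)=(D\phi_p)^{-1}X_2(\phi(p))$, and for functions, $f_1\sim f_2$ ($\mathcal{K}_{a_2^+}$-equivalence) means $f_1=h\cdot(f_2\circ\phi)$, in both cases for some conformal symmetry $\phi$ of $a_2^+$ and some non-zero function germ $h$. For $f\in\mathcal{E}$ put $\operatorname{codim}(f)=\operatorname{codim}(f\cdot X_{a_2^+})=\dim_{\mathbb{R}}\mathcal{E}/\langle f,\mathcal{L}_{X_{a_2^+}}f\rangle$. The class of a vector field has codimension $k$ if every $g\cdot X_{a_2^+}$ ($g\in\mathcal{E}$)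 in it has codimension $k$. The curve $\{f=0\}$ has the property of zeros if every $g\in\mathcal{E}$ vanishing on $\{f=0\}$ (near the origin) is a multiple of $f$ in $\mathcal{E}$. Finally, $j^kf$ is the Taylor polynomial of $f$ of degree $k$ at the origin. Theorem. Let $X=f\cdot X_{a_2^+}$ with $f\in\mathcal{E}$. Then $x^2+y^2$ is a first integral of $X$, and: 1. If $\{f=0\}$ has the property of zeros and $X$ has only one zero (i.e. near the origin $X$ vanishes only at the origin), then $X\sim X_{a_2^+}$ and $\operatorname{codim}(f)=0$. The equivalence class of $X_{a_2^+}$ has codimension $0$. 2. If the curve $\{f=0\}$ passes through the origin and is regular there ($f(0)=0$, $d_0f\neq0$), then automatically $\operatorname{codim}(f)=1$, and $X\sim x\cdot X_{a_2^+}=-xy\,\partial_x+x^2\,\partial_y$. The equivalence class of the latter field has codimension $1$. 3. If $f$ has finite codimension $k$, then $f\sim j^kf$ and therefore $X\sim j^kf\cdot X_{a_2^+}$. -/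

import Mathlib

open Filter Topology
open scoped ContDiff

namespace PlanarGerm

/-- The plane `ℝ²` with coordinates `x = p.1`, `y = p.2`. All objects below are considered near
the origin only. -/
abbrev Plane : Type := ℝ × ℝ

/-- The map `f` is of class `C^∞` on some neighbourhood of the origin, i.e. it represents the germ
at the origin of a smooth map. -/
def SmoothNear {F : Type} [NormedAddCommGroup F] [NormedSpace ℝ F] (f : Plane → F) : Prop :=
  ∀ᶠ p in 𝓝 (0 : Plane), ContDiffAt ℝ ∞ f p

/-- The algebra of real functions on the plane which are smooth near the origin. -/
def smoothFunctions : Subalgebra ℝ (Plane → ℝ) where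
  carrier := {f | SmoothNear f}
  mul_mem' := fun hf hg => by
    filter_upwards [hf, hg] with p h1 h2 using h1.mul h2
  add_mem' := fun hf hg => by
    filter_upwards [hf, hg] with p h1 h2 using h1.add h2
  algebraMap_mem' := fun _ => Eventually.of_forall fun _ => contDiffAt_const

/-- The ideal of functions which vanish on some neighbourhood of the origin. -/
def zeroNear : Ideal smoothFunctions where
  carrier := {f | ∀ᶠ p in 𝓝 (0 : Plane), f.1 p = 0}
  zero_mem' := Eventually.of_forall fun _ => rfl
  add_mem' := fun {f g} hf hg => by
    filter_upwards [hf, hg] with p h1 h2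
    change f.1 p + g.1 p = 0
    rw [h1, h2, add_zero]
  smul_mem' := fun c f hf => by
    filter_upwards [hf] with p h1
    change c.1 p * f.1 p = 0
    rw [h1, mul_zero]

/-- The ring (and `ℝ`-algebra) of germs at the origin of smooth functions: two functions have the
same germ if and only if they agree near the origin. -/
def SmoothGerms : Type := smoothFunctions ⧸ zeroNear

noncomputable instance instCommRingSmoothGerms : CommRing SmoothGerms :=
  inferInstanceAs (CommRing (smoothFunctions ⧸ zeroNear))

noncomputable instance instAlgebraSmoothGerms : Algebra ℝ SmoothGerms :=
  inferInstanceAs (Algebra ℝ (smoothFunctions ⧸ zeroNear))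

/-- The germ of `f`. -/
noncomputable def toGerm (f : Plane → ℝ) (hf : SmoothNear f) : SmoothGerms :=
  Ideal.Quotient.mk zeroNear ⟨f, hf⟩

/-- The Lie derivative of the function `f` along the vector field `X`. -/
noncomputable def lieDeriv (X : Plane → Plane) (f : Plane → ℝ) : Plane → ℝ :=
  fun p => fderiv ℝ f p (X p)

theorem SmoothNear.lieDeriv {X : Plane → Plane} {f : Plane → ℝ} (hX : SmoothNear X)
    (hf : SmoothNear f) : SmoothNear (lieDeriv X f) := by
  filter_upwards [hX, hf] with p h1 h2
  have h3 : ContDiffAt ℝ ∞ (fderiv ℝ f) p := h2.fderiv_right (m := ∞) (by simp)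
  exact h3.clm_apply h1

/-- The codimension of `f` with respect to the vector field `X`: the real dimension
(as a cardinal) of the quotient of the ring of smooth germs by the ideal `⟨f, L_X f⟩`. -/
noncomputable def codim (X : Plane → Plane) (hX : SmoothNear X) (f : Plane → ℝ)
    (hf : SmoothNear f) : Cardinal :=
  Module.rank ℝ (SmoothGerms ⧸
    (Ideal.span {toGerm f hf, toGerm (lieDeriv X f) (hX.lieDeriv hf)} : Ideal SmoothGerms))

/-- `φ` represents the germ of a diffeomorphism `(ℝ², 0) → (ℝ², 0)`. -/
def IsDiffeoGerm (φ : Plane → Plane) : Prop :=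
  φ 0 = 0 ∧ SmoothNear φ ∧
    ∃ ψ : Plane → Plane, ψ 0 = 0 ∧ SmoothNear ψ ∧
      (∀ᶠ p in 𝓝 (0 : Plane), ψ (φ p) = p) ∧ ∀ᶠ p in 𝓝 (0 : Plane), φ (ψ p) = p

/-- `h` represents a smooth germ which does not vanish at the origin (hence nowhere near it). -/
def IsNonzeroGerm (h : Plane → ℝ) : Prop :=
  SmoothNear h ∧ h 0 ≠ 0

/-- The pullback `φ^* b` of a 1-form. -/
noncomputable def pullbackForm (φ : Plane → Plane) (b : Plane → Plane →L[ℝ] ℝ) :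
    Plane → Plane →L[ℝ] ℝ :=
  fun p => (b (φ p)).comp (fderiv ℝ φ p)

/-- `φ` is a conformal symmetry of the 1-form `a`: a diffeomorphism germ with `a = k · φ^* a` for
some non-zero function germ `k`. -/
def IsConformalSymmetry (a : Plane → Plane →L[ℝ] ℝ) (φ : Plane → Plane) : Prop :=
  IsDiffeoGerm φ ∧ ∃ k : Plane → ℝ, IsNonzeroGerm k ∧
    ∀ᶠ p in 𝓝 (0 : Plane), a p = k p • pullbackForm φ a p

/-- Orbital `a`-conjugacy of germs of vector fields: `X₁ = h · φ^* X₂` for a conformal symmetry `φ`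
of `a` and a non-zero function germ `h`. Here `VectorField.pullback ℝ φ X₂` is the field
`p ↦ (Dφ_p)⁻¹ (X₂ (φ p))`. -/
def OrbitallyConjugate (a : Plane → Plane →L[ℝ] ℝ) (X₁ X₂ : Plane → Plane) : Prop :=
  ∃ φ : Plane → Plane, IsConformalSymmetry a φ ∧ ∃ h : Plane → ℝ, IsNonzeroGerm h ∧
    ∀ᶠ p in 𝓝 (0 : Plane), X₁ p = h p • VectorField.pullback ℝ φ X₂ p

/-- `K_a`-equivalence of function germs: `f₁ = h · (f₂ ∘ φ)` for a conformal symmetry `φ` of `a`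
and a non-zero function germ `h`. -/
def KEquivalent (a : Plane → Plane →L[ℝ] ℝ) (f₁ f₂ : Plane → ℝ) : Prop :=
  ∃ φ : Plane → Plane, IsConformalSymmetry a φ ∧ ∃ h : Plane → ℝ, IsNonzeroGerm h ∧
    ∀ᶠ p in 𝓝 (0 : Plane), f₁ p = h p * f₂ (φ p)

/-- The curve `{f = 0}` has the property of zeros: every smooth function germ that vanishes on it
is a smooth multiple of `f`. -/
def PropertyOfZeros (f : Plane → ℝ) : Prop :=
  ∀ g : Plane → ℝ, SmoothNear g → (∀ᶠ p in 𝓝 (0 : Plane), f p = 0 → g p = 0) →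
    ∃ q : Plane → ℝ, SmoothNear q ∧ ∀ᶠ p in 𝓝 (0 : Plane), g p = q p * f p

/-- The `k`-jet of `f` at the origin, as a polynomial function: its Taylor polynomial of
order `k`. -/
noncomputable def jet (k : ℕ) (f : Plane → ℝ) : Plane → ℝ :=
  fun p => ∑ i ∈ Finset.range (k + 1), (Nat.factorial i : ℝ)⁻¹ * iteratedFDeriv ℝ i f 0 (fun _ => p)

/-- The 1-form `a₂⁺ = x dx + y dy`. -/
noncomputable def aPlus : Plane → Plane →L[ℝ] ℝ :=
  fun p => p.1 • ContinuousLinearMap.fst ℝ ℝ ℝ + p.2 • ContinuousLinearMap.snd ℝ ℝ ℝ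

/-- The vector field `-y ∂/∂x + x ∂/∂y` corresponding to the 1-form `a₂⁺`. -/
def XPlus : Plane → Plane := fun p => (-p.2, p.1)

/-- `XPlus` is dual to `aPlus` with respect to the standard area form, the sign of the area form
being chosen so that the field is `-y ∂/∂x + x ∂/∂y`. -/
theorem aPlus_apply (p v : Plane) : aPlus p v = v.1 * (XPlus p).2 - v.2 * (XPlus p).1 := by
  simp [aPlus, XPlus]; ring

theorem smoothNear_XPlus : SmoothNear XPlus :=
  Eventually.of_forall fun _ => (contDiff_snd.neg.prodMk contDiff_fst).contDiffAt

/-- The codimension of `f` (and of `f · X`) for the field `X = -y ∂/∂x + x ∂/∂y`. -/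
noncomputable def codimPlus (f : Plane → ℝ) (hf : SmoothNear f) : Cardinal :=
  codim XPlus smoothNear_XPlus f hf

end PlanarGerm

open PlanarGerm

/-! Write L for the derivative along the rotation field, m for the ideal of germs vanishing at the
origin, and I = ⟨f, Lf⟩.

Everything reduces to function germs: duality between the form and the field shows that a conformal
symmetry rescales the rotation field by a non-zero function, so orbital conjugacy of multiples of
the field is `KEquivalent` of the factors (`orbitallyConjugate_iff_kEquivalent`). Rotations by a
point-dependent angle preserve x² + y², hence are conformal symmetries (`isConformalSymmetry_rot`),
and no others are needed to reach the normal forms.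

The core is finite determinacy (`exists_rotation_jet`). If E/I has dimension k, Nakayama gives m^k ⊆
I (`pow_le_of_rank_quotient_eq`). The remainder g = j^k f - f lies in m^(k+1), by Taylor's formula,
and so does Lg, because the rotation field preserves powers of m. Thus g and Lg lie in m·I. For f_t
= f + t g one can then solve g = c f_t + u L f_t smoothly in t and the point. Rotating by an angle
Y_t with dY_t/dt = -u, where u is taken at the rotated point, and multiplying by exp(-∫c) makes f_t
constant in t. Smooth dependence of Y_t on the point comes from the inverse function theorem on the
Banach space of continuous paths (`exists_smooth_solution`).

At a regular zero, I = m (`span_eq_vanishing`), so the codimension is 1; f is equivalent to its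
linear part, which a further rotation takes to a multiple of x. If {f = 0} has the property of zeros
and reduced to the origin, x would be a multiple of f, so f would be regular at 0 and its zero set a
curve; hence f(0) ≠ 0 and f is a unit. -/

namespace PlanarGerm

/-! ### Smoothness of superposition operators on spaces of continuous maps. -/

section Superposition

universe u

variable {K : Type*} [TopologicalSpace K] [CompactSpace K]

/-- Pointwise application of a path of continuous linear maps to a path of vectors. -/
noncomputable def pointwiseApply (K : Type*) [TopologicalSpace K] [CompactSpace K]
    (E F : Type*) [NormedAddCommGroup E] [NormedSpace ℝ E]
    [NormedAddCommGroup F] [NormedSpace ℝ F] :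
    C(K, E →L[ℝ] F) →L[ℝ] C(K, E) →L[ℝ] C(K, F) :=
  LinearMap.mkContinuous₂
    (LinearMap.mk₂ ℝ (fun (A : C(K, E →L[ℝ] F)) (v : C(K, E)) =>
        (⟨fun t => A t (v t), A.continuous.clm_apply v.continuous⟩ : C(K, F)))
      (fun _ _ _ => by ext; simp) (fun _ _ _ => by ext; simp)
      (fun _ _ _ => by ext; simp) (fun _ _ _ => by ext; simp)) 1
    (fun A v => by
      rw [ContinuousMap.norm_le _ (by positivity)]
      intro t
      rw [one_mul]
      refine ((A t).le_opNorm (v t)).trans ?_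
      gcongr
      exacts [A.norm_coe_le_norm t, v.norm_coe_le_norm t])

@[simp] theorem pointwiseApply_apply {E F : Type*} [NormedAddCommGroup E] [NormedSpace ℝ E]
    [NormedAddCommGroup F] [NormedSpace ℝ F] (A : C(K, E →L[ℝ] F)) (v : C(K, E)) (t : K) :
    pointwiseApply K E F A v t = A t (v t) := rfl

/-- The remainder estimate must be uniform over `K`. Continuity of `η ↦ g' ∘ η` at `θ` supplies it:
one `δ` controls the oscillation of `g'` on every ball around `θ t`, and the mean value inequality
does the rest. -/
theorem hasFDerivAt_superposition {E F : Type*} [NormedAddCommGroup E] [NormedSpace ℝ E]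
    [NormedAddCommGroup F] [NormedSpace ℝ F] (g : C(E, F)) (g' : C(E, E →L[ℝ] F))
    (hg : ∀ x, HasFDerivAt g (g' x) x) (θ : C(K, E)) :
    HasFDerivAt (fun η : C(K, E) => g.comp η) (pointwiseApply K E F (g'.comp θ)) θ := by
  rw [hasFDerivAt_iff_isLittleO_nhds_zero, Asymptotics.isLittleO_iff]
  intro ε hε
  have hc : Continuous fun η : C(K, E) => g'.comp η := ContinuousMap.continuous_postcomp g'
  obtain ⟨δ, hδ, hball⟩ := Metric.continuous_iff (α := C(K, E)) (β := C(K, E →L[ℝ] F)) |>.1 hc θ ε hε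
  filter_upwards [Metric.ball_mem_nhds (0 : C(K, E)) hδ] with η hη
  rw [mem_ball_zero_iff] at hη
  rw [ContinuousMap.norm_le _ (by positivity)]
  intro t
  have hb : ∀ z ∈ Metric.ball (θ t) δ, ‖fderiv ℝ g z - g' (θ t)‖ ≤ ε := by
    intro z hz
    -- Shifting `θ` by a constant turns a point `z` near `θ t` into a path near `θ`.
    have h1 : dist (θ + ContinuousMap.const K (z - θ t)) θ < δ := by
      rw [dist_eq_norm, add_sub_cancel_left]
      refine lt_of_le_of_lt ?_ (mem_ball_iff_norm.1 hz)
      exact (ContinuousMap.norm_le _ (norm_nonneg _)).2 fun _ => le_rfl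
    have h2 := (ContinuousMap.norm_coe_le_norm _ t).trans ((dist_eq_norm _ _).symm.trans_lt
      (hball _ h1)).le
    simpa [(hg z).fderiv] using h2
  have h := (convex_ball (θ t) δ).norm_image_sub_le_of_norm_fderiv_le' (𝕜 := ℝ) (f := g)
    (fun x _ => (hg x).differentiableAt) hb (Metric.mem_ball_self hδ)
    (y := θ t + η t) (by
      rw [mem_ball_iff_norm, add_sub_cancel_left]
      exact (η.norm_coe_le_norm t).trans_lt hη)
  rw [add_sub_cancel_left] at h
  exact h.trans (mul_le_mul_of_nonneg_left (η.norm_coe_le_norm t) hε.le)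

/-- The derivative is again a superposition operator, by `g'`, followed by a bounded linear map. The
target changes to `E →L[ℝ] F`, so `F` varies in the induction and must share the universe of `E`. -/
theorem contDiff_superposition_nat {E : Type u} [NormedAddCommGroup E] [NormedSpace ℝ E] (n : ℕ) :
    ∀ {F : Type u} [NormedAddCommGroup F] [NormedSpace ℝ F] (g : C(E, F)), ContDiff ℝ n g →
      ContDiff ℝ n (fun η : C(K, E) => g.comp η) := by
  induction n with
  | zero =>
    intro F _ _ g _
    exact contDiff_zero.2 (ContinuousMap.continuous_postcomp g)
  | succ n ih =>
    intro F _ _ g hg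
    obtain ⟨g', hg', hd⟩ := contDiff_succ_iff_hasFDerivAt.1 hg
    refine contDiff_succ_iff_hasFDerivAt.2
      ⟨_, ?_, hasFDerivAt_superposition g ⟨g', hg'.continuous⟩ hd⟩
    exact (pointwiseApply K E F).contDiff.comp (ih ⟨g', hg'.continuous⟩ hg')

/-- The superposition operator `η ↦ g ∘ η` on continuous maps from a compact space is smooth when
`g` is. -/
theorem contDiff_superposition {E F : Type u} [NormedAddCommGroup E] [NormedSpace ℝ E]
    [NormedAddCommGroup F] [NormedSpace ℝ F] (g : C(E, F)) (hg : ContDiff ℝ ∞ g) :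
    ContDiff ℝ ∞ (fun η : C(K, E) => g.comp η) :=
  contDiff_infty.2 fun n => contDiff_superposition_nat n g (contDiff_infty.1 hg n)

end Superposition

/-! ### Integration of paths and smooth dependence on parameters. -/

section Primitive

/-- The primitive vanishing at `0` of a continuous function on the unit interval. -/
noncomputable def primitive : C(unitInterval, ℝ) →L[ℝ] C(unitInterval, ℝ) :=
  LinearMap.mkContinuous
    { toFun := fun η => ⟨fun t => ∫ s in (0 : ℝ)..t, Set.IccExtend zero_le_one η s,
        (intervalIntegral.continuous_primitive
          (fun _ _ => (η.continuous.Icc_extend').intervalIntegrable _ _) 0).comp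
            continuous_subtype_val⟩
      map_add' := fun η ζ => by
        ext t
        exact intervalIntegral.integral_add (η.continuous.Icc_extend'.intervalIntegrable _ _)
          (ζ.continuous.Icc_extend'.intervalIntegrable _ _)
      map_smul' := fun c η => by
        ext t
        exact intervalIntegral.integral_const_mul c _ } 1
    (fun η => by
      rw [ContinuousMap.norm_le _ (by positivity)]
      intro t
      refine (intervalIntegral.norm_integral_le_of_norm_le_const (C := ‖η‖)
        fun s _ => η.norm_coe_le_norm _).trans ?_
      rw [sub_zero, abs_of_nonneg t.2.1, one_mul]
      exact mul_le_of_le_one_right (norm_nonneg _) t.2.2)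

theorem primitive_apply (η : C(unitInterval, ℝ)) (t : unitInterval) :
    primitive η t = ∫ s in (0 : ℝ)..t, Set.IccExtend zero_le_one η s := rfl

theorem primitive_one (η : C(unitInterval, ℝ)) (f : ℝ → ℝ) (h : ∀ t : unitInterval, η t = f t) :
    primitive η 1 = ∫ s in (0 : ℝ)..1, f s := by
  rw [primitive_apply]
  refine intervalIntegral.integral_congr fun s hs => ?_
  rw [Set.Icc.coe_one, Set.uIcc_of_le zero_le_one] at hs
  rw [Set.IccExtend_of_mem _ _ hs, h]

theorem hasDerivAt_primitive (η : C(unitInterval, ℝ)) (t : ℝ) :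
    HasDerivAt (fun t : ℝ => ∫ s in (0 : ℝ)..t, Set.IccExtend zero_le_one η s)
      (Set.IccExtend zero_le_one η t) t :=
  intervalIntegral.integral_hasDerivAt_right (η.continuous.Icc_extend'.intervalIntegrable _ _)
    (η.continuous.Icc_extend'.stronglyMeasurableAtFilter _ _)
    η.continuous.Icc_extend'.continuousAt

/-- The path `t ↦ (t, θ t, p)` depends smoothly on the path `θ` and the parameter `p`. -/
theorem contDiff_timePath {E : Type*} [NormedAddCommGroup E] [NormedSpace ℝ E] :
    ContDiff ℝ ∞ (fun q : E × C(unitInterval, ℝ) =>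
      (⟨fun t => ((t : ℝ), q.2 t, q.1), by fun_prop⟩ : C(unitInterval, ℝ × ℝ × E))) := by
  let t₀ : C(unitInterval, ℝ × ℝ × E) := ⟨fun t => ((t : ℝ), 0, 0), by fun_prop⟩
  let L₁ := (ContinuousLinearMap.inr ℝ ℝ (ℝ × E) ∘L
    ContinuousLinearMap.inl ℝ ℝ E).compLeftContinuous ℝ unitInterval
  let L₂ := (ContinuousLinearMap.const ℝ unitInterval : (ℝ × ℝ × E) →L[ℝ] _) ∘L
    ContinuousLinearMap.inr ℝ ℝ (ℝ × E) ∘L ContinuousLinearMap.inr ℝ ℝ E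
  have h : ContDiff ℝ ∞ fun q : E × C(unitInterval, ℝ) => t₀ + (L₁ q.2 + L₂ q.1) :=
    contDiff_const.add ((L₁.contDiff.comp contDiff_snd).add (L₂.contDiff.comp contDiff_fst))
  convert h using 2 with q
  ext t : 1
  simp [t₀, L₁, L₂]

variable {E : Type} [NormedAddCommGroup E] [NormedSpace ℝ E]

theorem contDiff_superposition_timePath {F : Type} [NormedAddCommGroup F] [NormedSpace ℝ F]
    (G : ℝ × ℝ × E → F) (hG : ContDiff ℝ ∞ G) :
    ContDiff ℝ ∞ (fun q : E × C(unitInterval, ℝ) =>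
      (⟨fun t => G ((t : ℝ), q.2 t, q.1), hG.continuous.comp (by fun_prop)⟩ :
        C(unitInterval, F))) :=
  (contDiff_superposition ⟨G, hG.continuous⟩ hG).comp contDiff_timePath

/-- Smooth dependence of an integral on a parameter. -/
theorem contDiff_integral_param (G : ℝ × E → ℝ) (hG : ContDiff ℝ ∞ G) :
    ContDiff ℝ ∞ (fun p => ∫ t in (0 : ℝ)..1, G (t, p)) := by
  have h1 := (contDiff_superposition_timePath (fun q : ℝ × ℝ × E => G (q.1, q.2.2))
    (hG.comp (by fun_prop))).comp (contDiff_id.prodMk contDiff_const :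
      ContDiff ℝ ∞ fun p : E => (p, (0 : C(unitInterval, ℝ))))
  have h2 := (ContinuousMap.evalCLM ℝ (1 : unitInterval) ∘L primitive).contDiff.comp h1
  convert h2 using 2 with p
  exact (primitive_one _ _ fun t => rfl).symm

end Primitive

/-! ### Inverse functions and smooth solutions of differential equations. -/

/-- The inverse function theorem: the local inverse is smooth on a whole neighbourhood. -/
theorem exists_smooth_localInverse {E : Type*} [NormedAddCommGroup E] [NormedSpace ℝ E]
    [CompleteSpace E] {f : E → E} {a : E} (hf : ∀ᶠ x in 𝓝 a, ContDiffAt ℝ ∞ f x)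
    (e : E ≃L[ℝ] E) (he : HasFDerivAt f (e : E →L[ℝ] E) a) :
    ∃ g : E → E, g (f a) = a ∧ (∀ᶠ y in 𝓝 (f a), ContDiffAt ℝ ∞ g y) ∧
      (∀ᶠ x in 𝓝 a, g (f x) = x) ∧ ∀ᶠ y in 𝓝 (f a), f (g y) = y := by
  have hfa := hf.self_of_nhds
  let P := hfa.toOpenPartialHomeomorph f he (by simp)
  have ha : a ∈ P.source := hfa.mem_toOpenPartialHomeomorph_source he (by simp)
  have hPa : P.symm (f a) = a := P.left_inv ha
  have hta : f a ∈ P.target := P.map_source ha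
  have hcont : Tendsto P.symm (𝓝 (f a)) (𝓝 a) := by
    have := P.continuousAt_symm hta
    rwa [ContinuousAt, hPa] at this
  -- Smoothness of the inverse at a nearby point needs an invertible derivative there; invertible
  -- operators form an open set.
  have hinv : ∀ᶠ x in 𝓝 a, ∃ e' : E ≃L[ℝ] E, (e' : E →L[ℝ] E) = fderiv ℝ f x := by
    have hc : ContinuousAt (fderiv ℝ f) a :=
      (hfa.fderiv_right (m := 0) (by simp)).continuousAt
    rw [ContinuousAt, he.fderiv] at hc
    exact hc.eventually (ContinuousLinearEquiv.nhds e)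
  refine ⟨P.symm, hPa, ?_, ?_, ?_⟩
  · filter_upwards [P.open_target.mem_nhds hta, hcont.eventually hinv, hcont.eventually hf]
      with y hy ⟨e', he'⟩ hs
    refine P.contDiffAt_symm hy (f₀' := e') ?_ hs
    rw [he']
    exact (hs.differentiableAt (by simp)).hasFDerivAt
  · filter_upwards [P.open_source.mem_nhds ha] with x hx using P.left_inv hx
  · filter_upwards [P.open_target.mem_nhds hta] with y hy using P.right_inv hy

/-- Solutions of a family of scalar equations `θ' = v(t, θ, p)`, `θ(0) = 0`, on the unit interval
depend smoothly on the parameter `p` near a parameter for which the right hand side vanishes. -/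
theorem exists_smooth_solution {E : Type} [NormedAddCommGroup E] [NormedSpace ℝ E]
    [CompleteSpace E] (v : ℝ × ℝ × E → ℝ) (hv : ContDiff ℝ ∞ v) (hv0 : ∀ t θ, v (t, θ, 0) = 0) :
    ∃ Θ : E → C(unitInterval, ℝ), Θ 0 = 0 ∧ (∀ᶠ p in 𝓝 (0 : E), ContDiffAt ℝ ∞ Θ p) ∧
      ∀ᶠ p in 𝓝 (0 : E), Θ p = primitive ⟨fun t => v ((t : ℝ), Θ p t, p),
        hv.continuous.comp (by fun_prop)⟩ := by
  let N : E × C(unitInterval, ℝ) → C(unitInterval, ℝ) := fun q =>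
    ⟨fun t => v ((t : ℝ), q.2 t, q.1), hv.continuous.comp (by fun_prop)⟩
  have hN : ContDiff ℝ ∞ N := contDiff_superposition_timePath v hv
  have hN0 : ∀ η, N (0, η) = 0 := fun η => by ext t; exact hv0 _ _
  -- A solution for the parameter `p` is a path `η` with `Φ (p, η) = (p, 0)`, so a local inverse of
  -- `Φ` yields all solutions at once.
  let Φ : E × C(unitInterval, ℝ) → E × C(unitInterval, ℝ) := fun q => (q.1, q.2 - primitive (N q))
  have hΦ : ContDiff ℝ ∞ Φ :=
    contDiff_fst.prodMk (contDiff_snd.sub (primitive.contDiff.comp hN))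
  have hΦ0 : Φ 0 = 0 := by
    change ((0 : E), (0 : C(unitInterval, ℝ)) - primitive (N (0, 0))) = 0
    rw [hN0, map_zero, sub_zero]; rfl
  let N' := fderiv ℝ N 0
  have hN' : HasFDerivAt N N' 0 := (hN.differentiable (by simp) 0).hasFDerivAt
  -- `N` vanishes for `p = 0` whatever the path, so its derivative kills path directions. Hence the
  -- derivative of `Φ` is unipotent and triangular, with the explicit inverse in `e`.
  have hN'0 : ∀ η, N' (0, η) = 0 := by
    intro η
    have h1 := HasFDerivAt.comp (x := (0 : C(unitInterval, ℝ))) (g := N) (g' := N') hN'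
      (hasFDerivAt_prodMk_right (0 : E) (0 : C(unitInterval, ℝ)))
    have h2 : (N ∘ fun η => ((0 : E), η)) = fun _ => 0 := funext hN0
    rw [h2] at h1
    have h3 := h1.unique (hasFDerivAt_const _ _)
    exact congrArg (fun L => L η) h3
  let B : E →L[ℝ] C(unitInterval, ℝ) := primitive ∘L N' ∘L ContinuousLinearMap.inl ℝ E _
  have hNB : ∀ q : E × C(unitInterval, ℝ), primitive (N' q) = B q.1 := by
    intro q
    have : q = (q.1, 0) + (0, q.2) := by simp
    conv_lhs => rw [this, map_add, hN'0, add_zero]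
    rfl
  let e : (E × C(unitInterval, ℝ)) ≃L[ℝ] (E × C(unitInterval, ℝ)) :=
    ContinuousLinearEquiv.equivOfInverse
      ((ContinuousLinearMap.fst ℝ _ _).prod (ContinuousLinearMap.snd ℝ _ _ -
        B ∘L ContinuousLinearMap.fst ℝ _ _))
      ((ContinuousLinearMap.fst ℝ _ _).prod (ContinuousLinearMap.snd ℝ _ _ +
        B ∘L ContinuousLinearMap.fst ℝ _ _))
      (fun q => by simp) (fun q => by simp)
  have he : HasFDerivAt Φ (e : _ →L[ℝ] _) 0 := by
    have h : HasFDerivAt Φ ((ContinuousLinearMap.fst ℝ _ _).prod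
        (ContinuousLinearMap.snd ℝ _ _ - primitive ∘L N')) 0 :=
      hasFDerivAt_fst.prodMk (hasFDerivAt_snd.sub (primitive.hasFDerivAt.comp _ hN'))
    convert h using 1
    refine ContinuousLinearMap.ext fun q => ?_
    simp [e, hNB]
  obtain ⟨g, hg0, hgs, -, hgr⟩ := exists_smooth_localInverse
    (Eventually.of_forall fun x => hΦ.contDiffAt) e he
  rw [hΦ0] at hg0 hgs hgr
  have hι : Tendsto (fun p : E => (p, (0 : C(unitInterval, ℝ)))) (𝓝 0) (𝓝 0) :=
    Continuous.tendsto' (by fun_prop) _ _ rfl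
  refine ⟨fun p => (g (p, 0)).2, by change (g 0).2 = 0; rw [hg0]; rfl, ?_, ?_⟩
  · filter_upwards [hι.eventually hgs] with p hp
    exact (hp.comp p (contDiff_id.prodMk contDiff_const).contDiffAt).snd
  · filter_upwards [hι.eventually hgr] with p hp
    have h1 : (g (p, 0)).1 = p := congrArg Prod.fst hp
    have h2 : (g (p, 0)).2 - primitive (N (g (p, 0))) = 0 := congrArg Prod.snd hp
    have h3 : g (p, 0) = (p, (g (p, 0)).2) := Prod.ext h1 rfl
    rw [h3] at h2
    exact sub_eq_zero.1 h2

/-! ### The local ring of smooth germs. -/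

section Germs

theorem _root_.ContDiff.smoothNear {F : Type} [NormedAddCommGroup F] [NormedSpace ℝ F]
    {f : Plane → F} (hf : ContDiff ℝ ∞ f) : SmoothNear f :=
  Eventually.of_forall fun _ => hf.contDiffAt

/-- Every germ has a representative which is smooth everywhere. -/
theorem SmoothNear.exists_contDiff {f : Plane → ℝ} (hf : SmoothNear f) :
    ∃ F : Plane → ℝ, ContDiff ℝ ∞ F ∧ F =ᶠ[𝓝 0] f := by
  obtain ⟨r, hr, hball⟩ := Metric.eventually_nhds_iff_ball.1 hf
  let χ : ContDiffBump (0 : Plane) := ⟨r / 4, r / 2, by positivity, by linarith⟩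
  refine ⟨fun p => χ p * f p, contDiff_iff_contDiffAt.2 fun p => ?_, ?_⟩
  · by_cases hp : p ∈ tsupport χ
    · refine χ.contDiff.contDiffAt.mul (hball p ?_)
      rw [χ.tsupport_eq] at hp
      exact Metric.closedBall_subset_ball (by change r / 2 < r; linarith) hp
    · refine (contDiffAt_const (c := (0 : ℝ))).congr_of_eventuallyEq ?_
      filter_upwards [(isClosed_tsupport χ).isOpen_compl.mem_nhds hp] with q hq
      rw [image_eq_zero_of_notMem_tsupport hq, zero_mul]
  · filter_upwards [χ.eventuallyEq_one] with p hp
    rw [hp, Pi.one_apply, one_mul]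

/-- The projection from functions to germs. -/
noncomputable def mkGerm : smoothFunctions →ₐ[ℝ] SmoothGerms := Ideal.Quotient.mkₐ ℝ zeroNear

theorem toGerm_eq_iff {f g : Plane → ℝ} (hf : SmoothNear f) (hg : SmoothNear g) :
    toGerm f hf = toGerm g hg ↔ f =ᶠ[𝓝 0] g := by
  refine (Ideal.Quotient.eq (I := zeroNear)).trans ?_
  change (∀ᶠ p in 𝓝 (0 : Plane), f p - g p = 0) ↔ _
  simp only [sub_eq_zero]
  rfl

theorem exists_contDiff_toGerm (a : SmoothGerms) :
    ∃ (f : Plane → ℝ) (hf : ContDiff ℝ ∞ f), toGerm f hf.smoothNear = a := by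
  obtain ⟨⟨f, hf⟩, rfl⟩ := Ideal.Quotient.mk_surjective a
  obtain ⟨F, hF, h⟩ := SmoothNear.exists_contDiff hf
  exact ⟨F, hF, (toGerm_eq_iff hF.smoothNear hf).2 h⟩

theorem SmoothNear.add {f g : Plane → ℝ} (hf : SmoothNear f) (hg : SmoothNear g) :
    SmoothNear (fun p => f p + g p) := by
  filter_upwards [hf, hg] with p h1 h2 using h1.add h2

theorem SmoothNear.mul {f g : Plane → ℝ} (hf : SmoothNear f) (hg : SmoothNear g) :
    SmoothNear (fun p => f p * g p) := by
  filter_upwards [hf, hg] with p h1 h2 using h1.mul h2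

theorem SmoothNear.neg {f : Plane → ℝ} (hf : SmoothNear f) : SmoothNear (fun p => -f p) := by
  filter_upwards [hf] with p h1 using h1.neg

theorem SmoothNear.inv {f : Plane → ℝ} (hf : SmoothNear f) (h0 : f 0 ≠ 0) :
    SmoothNear (fun p => (f p)⁻¹) := by
  filter_upwards [hf, hf.self_of_nhds.continuousAt.eventually_ne h0] with p h1 h2 using h1.inv h2

theorem toGerm_add {f g : Plane → ℝ} (hf : SmoothNear f) (hg : SmoothNear g) :
    toGerm f hf + toGerm g hg = toGerm (fun p => f p + g p) (hf.add hg) := rfl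

theorem toGerm_mul {f g : Plane → ℝ} (hf : SmoothNear f) (hg : SmoothNear g) :
    toGerm f hf * toGerm g hg = toGerm (fun p => f p * g p) (hf.mul hg) := rfl

theorem toGerm_neg {f : Plane → ℝ} (hf : SmoothNear f) :
    -toGerm f hf = toGerm (fun p => -f p) hf.neg := rfl

theorem toGerm_one : (1 : SmoothGerms) = toGerm (fun _ => 1) contDiff_const.smoothNear := rfl

/-- The value of a germ at the origin. -/
noncomputable def evalZero : SmoothGerms →ₐ[ℝ] ℝ :=
  Ideal.Quotient.liftₐ zeroNear
    { toFun := fun f => f.1 0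
      map_one' := rfl
      map_mul' := fun _ _ => rfl
      map_zero' := rfl
      map_add' := fun _ _ => rfl
      commutes' := fun _ => rfl } fun f hf =>
      (show ∀ᶠ p in 𝓝 (0 : Plane), f.1 p = 0 from hf).self_of_nhds

@[simp] theorem evalZero_toGerm {f : Plane → ℝ} (hf : SmoothNear f) :
    evalZero (toGerm f hf) = f 0 := rfl

theorem isUnit_of_evalZero_ne_zero {a : SmoothGerms} (ha : evalZero a ≠ 0) : IsUnit a := by
  obtain ⟨f, hf, rfl⟩ := exists_contDiff_toGerm a
  have h0 : f 0 ≠ 0 := ha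
  refine IsUnit.of_mul_eq_one (toGerm _ (hf.smoothNear.inv h0)) ?_
  rw [toGerm_mul, toGerm_one, toGerm_eq_iff]
  filter_upwards [hf.continuous.continuousAt.eventually_ne h0] with p hp
  exact mul_inv_cancel₀ hp

/-- The ideal of germs vanishing at the origin. -/
noncomputable def vanishing : Ideal SmoothGerms := RingHom.ker evalZero

theorem mem_vanishing {a : SmoothGerms} : a ∈ vanishing ↔ evalZero a = 0 := Iff.rfl

theorem toGerm_mem_vanishing {f : Plane → ℝ} (hf : SmoothNear f) :
    toGerm f hf ∈ vanishing ↔ f 0 = 0 := Iff.rfl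

theorem vanishing_le_jacobson : vanishing ≤ Ideal.jacobson ⊥ := by
  intro a ha
  rw [Ideal.mem_jacobson_bot]
  intro b
  apply isUnit_of_evalZero_ne_zero
  rw [map_add, map_mul, mem_vanishing.1 ha, zero_mul, map_one, zero_add]
  exact one_ne_zero

end Germs

/-! ### Taylor's formula and powers of the maximal ideal. -/

section Taylor

/-- The coordinate functions. -/
noncomputable def coordFun (j : Fin 2) : smoothFunctions :=
  ![⟨Prod.fst, (contDiff_fst : ContDiff ℝ ∞ (Prod.fst : Plane → ℝ)).smoothNear⟩,
    ⟨Prod.snd, (contDiff_snd : ContDiff ℝ ∞ (Prod.snd : Plane → ℝ)).smoothNear⟩] j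

/-- The ideal generated by the coordinates. -/
noncomputable def coordIdeal : Ideal SmoothGerms :=
  Ideal.span (Set.range fun j => mkGerm (coordFun j))

theorem contDiff_jet (n : ℕ) (f : Plane → ℝ) : ContDiff ℝ ∞ (jet n f) :=
  ContDiff.sum fun _ _ => contDiff_const.mul
    ((ContinuousMultilinearMap.contDiff _).comp (contDiff_pi.2 fun _ => contDiff_id))

theorem jet_congr (n : ℕ) {f g : Plane → ℝ} (h : f =ᶠ[𝓝 0] g) : jet n f = jet n g := by
  ext p
  simp only [jet, (h.iteratedFDeriv ℝ _).self_of_nhds]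

/-- In the integral remainder, expand the multilinear form `D^(n+1) f (p, ..., p)` in the standard
basis: each term is a product of `n + 1` coordinates times an integral smooth in `p`. -/
theorem sub_jet_mem {f : Plane → ℝ} (hf : ContDiff ℝ ∞ f) (n : ℕ) :
    toGerm (fun p => f p - jet n f p) (hf.sub (contDiff_jet n f)).smoothNear
      ∈ coordIdeal ^ (n + 1) := by
  let e : Fin 2 → Plane := ![(1, 0), (0, 1)]
  have hp : ∀ p : Plane, p = ∑ j, (coordFun j).1 p • e j := by
    intro p
    simp [coordFun, e, Fin.sum_univ_two]
  let G : (Fin (n + 1) → Fin 2) → ℝ × Plane → ℝ := fun r q =>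
    (1 - q.1) ^ n * iteratedFDeriv ℝ (n + 1) f (q.1 • q.2) (fun i => e (r i))
  have hG : ∀ r, ContDiff ℝ ∞ (G r) := by
    intro r
    have h1 : ContDiff ℝ ∞ (iteratedFDeriv ℝ (n + 1) f) := hf.iteratedFDeriv_right (by exact_mod_cast le_top)
    have h2 := (ContinuousMultilinearMap.apply ℝ (fun _ : Fin (n + 1) => Plane) ℝ
      (fun i => e (r i))).contDiff (n := ∞) |>.comp
        (h1.comp (contDiff_fst.smul contDiff_snd : ContDiff ℝ ∞ fun q : ℝ × Plane => q.1 • q.2))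
    exact ((contDiff_const.sub contDiff_fst).pow n).mul h2
  let C : (Fin (n + 1) → Fin 2) → smoothFunctions := fun r =>
    ⟨fun p => (n.factorial : ℝ)⁻¹ * ∫ t in (0 : ℝ)..1, G r (t, p),
      (contDiff_const.mul (contDiff_integral_param (G r) (hG r))).smoothNear⟩
  have key : (⟨fun p => f p - jet n f p, (hf.sub (contDiff_jet n f)).smoothNear⟩ :
      smoothFunctions) = ∑ r, (∏ i, coordFun (r i)) * C r := by
    apply Subtype.ext
    ext p
    have h := map_add_eq_sum_add_integral_iteratedFDeriv (f := f) (x := 0) (y := p) (n := n)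
      (fun t _ => (hf.of_le (by exact_mod_cast le_top)).contDiffAt)
    simp only [zero_add, smul_eq_mul] at h
    have hint : ∀ t : ℝ, (1 - t) ^ n * iteratedFDeriv ℝ (n + 1) f (t • p) (fun _ => p)
        = ∑ r, (∏ i, (coordFun (r i)).1 p) * G r (t, p) := by
      intro t
      have h1 : iteratedFDeriv ℝ (n + 1) f (t • p) (fun _ => p) =
          iteratedFDeriv ℝ (n + 1) f (t • p) (fun _ => ∑ j, (coordFun j).1 p • e j) := by
        rw [← hp p]
      rw [h1, ContinuousMultilinearMap.map_sum, Finset.mul_sum]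
      refine Finset.sum_congr rfl fun r _ => ?_
      rw [ContinuousMultilinearMap.map_smul_univ]
      simp only [G, smul_eq_mul]
      ring
    have hsum : ∫ t in (0 : ℝ)..1, ∑ r, (∏ i, (coordFun (r i)).1 p) * G r (t, p)
        = ∑ r, (∏ i, (coordFun (r i)).1 p) * ∫ t in (0 : ℝ)..1, G r (t, p) := by
      rw [intervalIntegral.integral_finsetSum]
      · simp_rw [intervalIntegral.integral_const_mul]
      · intro r _
        refine Continuous.intervalIntegrable (continuous_const.mul ?_) _ _
        exact (hG r).continuous.comp (by fun_prop : Continuous fun t : ℝ => (t, p))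
    simp_rw [hint] at h
    rw [hsum, Finset.mul_sum] at h
    change f p - jet n f p = _
    rw [sub_eq_iff_eq_add', h]
    congr 1
    rw [AddSubmonoidClass.coe_finsetSum, Finset.sum_apply]
    refine Finset.sum_congr rfl fun r _ => ?_
    change _ = ((∏ i, coordFun (r i) : smoothFunctions) : Plane → ℝ) p * (C r).1 p
    rw [SubmonoidClass.coe_finsetProd, Finset.prod_apply]
    simp only [C]
    ring
  change mkGerm _ ∈ _
  rw [key, map_sum]
  refine Ideal.sum_mem _ fun r _ => ?_
  rw [map_mul, map_prod]
  refine Ideal.mul_mem_right _ _ ?_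
  have h := Ideal.prod_mem_prod (s := (Finset.univ : Finset (Fin (n + 1))))
    (I := fun _ => coordIdeal)
    (x := fun i => mkGerm (coordFun (r i)))
    (fun i _ => Ideal.subset_span ⟨r i, rfl⟩)
  simpa using h

theorem jet_zero (f : Plane → ℝ) (p : Plane) : jet 0 f p = f 0 := by
  simp [jet]

theorem vanishing_eq_coordIdeal : vanishing = coordIdeal := by
  apply le_antisymm
  · intro a ha
    obtain ⟨f, hf, rfl⟩ := exists_contDiff_toGerm a
    have h0 : f 0 = 0 := ha
    have h := sub_jet_mem hf 0
    simpa [jet_zero, h0] using h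
  · rw [coordIdeal, Ideal.span_le]
    rintro _ ⟨j, rfl⟩
    change (coordFun j).1 0 = 0
    fin_cases j <;> rfl

theorem jet_sub_mem {f : Plane → ℝ} (hf : ContDiff ℝ ∞ f) (n : ℕ) :
    toGerm (fun p => jet n f p - f p) ((contDiff_jet n f).sub hf).smoothNear
      ∈ vanishing ^ (n + 1) := by
  rw [vanishing_eq_coordIdeal, ← neg_mem_iff, toGerm_neg]
  simpa using sub_jet_mem hf n

end Taylor

/-! ### Nakayama's lemma for ideals of finite codimension. -/

/-- If `R ⧸ I` has dimension `k` and `m` lies in the Jacobson radical, then `m ^ k ≤ I`. -/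
theorem pow_le_of_rank_quotient_eq {R : Type*} [CommRing R] [Algebra ℝ R] {m I : Ideal R}
    (hm : m ≤ Ideal.jacobson ⊥) {k : ℕ} (hk : Module.rank ℝ (R ⧸ I) = k) : m ^ k ≤ I := by
  have hfin : Module.Finite ℝ (R ⧸ I) :=
    Module.rank_lt_aleph0_iff.1 (hk ▸ Cardinal.natCast_lt_aleph0)
  have hrank : Module.finrank ℝ (R ⧸ I) = k := Module.finrank_eq_of_rank_eq hk
  have hnoeth : IsNoetherianRing (R ⧸ I) := isNoetherian_of_tower ℝ inferInstance
  let 𝔫 : Ideal (R ⧸ I) := m.map (Ideal.Quotient.mk I)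
  have h𝔫 : 𝔫 ≤ Ideal.jacobson ⊥ := by
    intro a ha
    obtain ⟨x, hx, rfl⟩ :=
      (Ideal.mem_map_iff_of_surjective _ Ideal.Quotient.mk_surjective).1 ha
    rw [Ideal.mem_jacobson_bot]
    intro b
    obtain ⟨y, rfl⟩ := Ideal.Quotient.mk_surjective b
    have h := (Ideal.mem_jacobson_bot.1 (hm hx) y).map (Ideal.Quotient.mk I)
    rwa [map_add, map_mul, map_one] at h
  -- The powers of `𝔫` lose at least one dimension at each step until they vanish: equality of two
  -- consecutive powers forces zero by Nakayama.
  have hstep : ∀ i : ℕ, 𝔫 ^ i = ⊥ ∨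
      Module.finrank ℝ ((𝔫 ^ i).restrictScalars ℝ) + i ≤ k := by
    intro i
    induction i with
    | zero =>
      right
      rw [add_zero, ← hrank]
      exact Submodule.finrank_le _
    | succ i ih =>
      rcases ih with h | h
      · left
        rw [pow_succ, h, Ideal.bot_mul]
      · have hle : 𝔫 ^ (i + 1) ≤ 𝔫 ^ i := Ideal.pow_le_pow_right (Nat.le_succ i)
        rcases hle.eq_or_lt with heq | hlt
        · left
          rw [heq]
          refine Submodule.eq_bot_of_le_smul_of_le_jacobson_bot 𝔫 _
            (IsNoetherian.noetherian _) ?_ h𝔫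
          rw [smul_eq_mul, ← pow_succ', heq]
        · right
          have := Submodule.finrank_lt_finrank_of_lt
            (show (𝔫 ^ (i + 1)).restrictScalars ℝ < (𝔫 ^ i).restrictScalars ℝ from hlt)
          omega
  have hbot : 𝔫 ^ k = ⊥ := by
    rcases hstep k with h | h
    · exact h
    · have h0 : Module.finrank ℝ ((𝔫 ^ k).restrictScalars ℝ) = 0 := by omega
      exact (Submodule.restrictScalars_eq_bot_iff ℝ _ _).1 (Submodule.finrank_eq_zero.1 h0)
  rw [← Ideal.map_pow, Ideal.map_eq_bot_iff_le_ker, Ideal.mk_ker] at hbot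
  exact hbot

/-! ### Derivation along the rotation field. -/

section LieDerivative

theorem lieDeriv_congr (X : Plane → Plane) {f g : Plane → ℝ} (h : f =ᶠ[𝓝 0] g) :
    lieDeriv X f =ᶠ[𝓝 0] lieDeriv X g := by
  filter_upwards [h.fderiv (𝕜 := ℝ)] with p hp
  simp only [lieDeriv, hp]

theorem lieDeriv_mul_eventuallyEq (X : Plane → Plane) {f g : Plane → ℝ} (hf : SmoothNear f)
    (hg : SmoothNear g) : lieDeriv X (fun p => f p * g p) =ᶠ[𝓝 0]
      fun p => f p * lieDeriv X g p + g p * lieDeriv X f p := by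
  filter_upwards [hf, hg] with p h1 h2
  simp [lieDeriv, fderiv_fun_mul (h1.differentiableAt (by simp)) (h2.differentiableAt (by simp))]

theorem lieDeriv_add_eventuallyEq (X : Plane → Plane) {f g : Plane → ℝ} (hf : SmoothNear f)
    (hg : SmoothNear g) : lieDeriv X (fun p => f p + g p) =ᶠ[𝓝 0]
      fun p => lieDeriv X f p + lieDeriv X g p := by
  filter_upwards [hf, hg] with p h1 h2
  simp [lieDeriv, fderiv_fun_add (h1.differentiableAt (by simp)) (h2.differentiableAt (by simp))]

theorem lieDeriv_XPlus_zero (f : Plane → ℝ) : lieDeriv XPlus f 0 = 0 := by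
  have : XPlus 0 = 0 := by simp [XPlus]
  rw [lieDeriv, this, map_zero]

/-- The rotation field preserves the powers of the ideal of germs vanishing at the origin. -/
theorem toGerm_lieDeriv_mem_pow (n : ℕ) : ∀ {f : Plane → ℝ} (hf : SmoothNear f),
    toGerm f hf ∈ vanishing ^ n →
      toGerm (lieDeriv XPlus f) (smoothNear_XPlus.lieDeriv hf) ∈ vanishing ^ n := by
  induction n with
  | zero => intro f hf _; simp
  | succ n ih =>
    suffices h : ∀ a ∈ vanishing ^ (n + 1), ∀ (f : Plane → ℝ) (hf : SmoothNear f),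
        toGerm f hf = a →
          toGerm (lieDeriv XPlus f) (smoothNear_XPlus.lieDeriv hf) ∈ vanishing ^ (n + 1) from
      fun {f} hf hmem => h _ hmem f hf rfl
    intro a ha
    rw [pow_succ] at ha
    refine Submodule.mul_induction_on (C := fun a => ∀ (f : Plane → ℝ) (hf : SmoothNear f),
      toGerm f hf = a → toGerm (lieDeriv XPlus f) (smoothNear_XPlus.lieDeriv hf)
        ∈ vanishing ^ (n + 1)) ha ?_ ?_
    · intro b hb c hc f hf hfa
      obtain ⟨u, hu, rfl⟩ := exists_contDiff_toGerm b
      obtain ⟨v, hv, rfl⟩ := exists_contDiff_toGerm c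
      replace hu := hu.smoothNear
      replace hv := hv.smoothNear
      rw [toGerm_mul, toGerm_eq_iff] at hfa
      have key : toGerm (lieDeriv XPlus f) (smoothNear_XPlus.lieDeriv hf) =
          toGerm u hu * toGerm _ (smoothNear_XPlus.lieDeriv hv) +
          toGerm v hv * toGerm _ (smoothNear_XPlus.lieDeriv hu) := by
        rw [toGerm_mul, toGerm_mul, toGerm_add, toGerm_eq_iff]
        exact (lieDeriv_congr _ hfa).trans (lieDeriv_mul_eventuallyEq _ hu hv)
      rw [key, pow_succ]
      -- By Leibniz there are two terms. In the first, the derivative of `v` vanishes at the origin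
      -- because the field does; in the second, the derivative of `u` stays in the `n`-th power by
      -- induction.
      refine Ideal.add_mem _ (Ideal.mul_mem_mul hb ?_) ?_
      · exact (toGerm_mem_vanishing _).2 (lieDeriv_XPlus_zero v)
      · rw [mul_comm (toGerm v hv)]
        exact Ideal.mul_mem_mul (ih hu hb) hc
    · intro b c hb hc f hf hfa
      obtain ⟨u, hu, rfl⟩ := exists_contDiff_toGerm b
      obtain ⟨v, hv, rfl⟩ := exists_contDiff_toGerm c
      replace hu := hu.smoothNear
      replace hv := hv.smoothNear
      rw [toGerm_add, toGerm_eq_iff] at hfa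
      have key : toGerm (lieDeriv XPlus f) (smoothNear_XPlus.lieDeriv hf) =
          toGerm _ (smoothNear_XPlus.lieDeriv hu) + toGerm _ (smoothNear_XPlus.lieDeriv hv) := by
        rw [toGerm_add, toGerm_eq_iff]
        exact (lieDeriv_congr _ hfa).trans (lieDeriv_add_eventuallyEq _ hu hv)
      rw [key]
      exact Ideal.add_mem _ (hb u hu rfl) (hc v hv rfl)

end LieDerivative

/-! ### Codimension zero and one. -/

section Codimension

theorem codimPlus_eq_zero {f : Plane → ℝ} (hf : SmoothNear f) (h0 : f 0 ≠ 0) :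
    codimPlus f hf = 0 := by
  have htop : (Ideal.span {toGerm f hf,
      toGerm (lieDeriv XPlus f) (smoothNear_XPlus.lieDeriv hf)} : Ideal SmoothGerms) = ⊤ :=
    Ideal.eq_top_of_isUnit_mem _ (Ideal.subset_span (by simp))
      (isUnit_of_evalZero_ne_zero (a := toGerm f hf) h0)
  have : Subsingleton (SmoothGerms ⧸ (Ideal.span {toGerm f hf,
      toGerm (lieDeriv XPlus f) (smoothNear_XPlus.lieDeriv hf)} : Ideal SmoothGerms)) :=
    Ideal.Quotient.subsingleton_iff.2 htop
  exact rank_subsingleton' ℝ _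

/-- Hadamard's lemma: a germ vanishing at the origin is a combination of the coordinates. -/
theorem exists_hadamard {f : Plane → ℝ} (hf : SmoothNear f) (h0 : f 0 = 0) :
    ∃ f₁ f₂ : Plane → ℝ, ContDiff ℝ ∞ f₁ ∧ ContDiff ℝ ∞ f₂ ∧
      f =ᶠ[𝓝 0] fun p => f₁ p * p.1 + f₂ p * p.2 := by
  have h : toGerm f hf ∈ vanishing := h0
  rw [vanishing_eq_coordIdeal, coordIdeal,
    show (Set.range fun j => mkGerm (coordFun j)) = {mkGerm (coordFun 0), mkGerm (coordFun 1)} by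
      ext a; simp [Fin.exists_fin_two, eq_comm], Ideal.mem_span_pair] at h
  obtain ⟨a, b, hab⟩ := h
  obtain ⟨f₁, h₁, rfl⟩ := exists_contDiff_toGerm a
  obtain ⟨f₂, h₂, rfl⟩ := exists_contDiff_toGerm b
  exact ⟨f₁, f₂, h₁, h₂, (toGerm_eq_iff hf ((h₁.smoothNear.mul contDiff_fst.smoothNear).add
    (h₂.smoothNear.mul contDiff_snd.smoothNear))).1 hab.symm⟩

/-- With f = f₁x + f₂y, the rules Lx = -y and Ly = x give Lf = (f₂ + Lf₁)x + (-f₁ + Lf₂)y. The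
coefficient determinant is -(f₁² + f₂²) at the origin, a unit, so Cramer's rule recovers x and y
from f and Lf. -/
theorem span_eq_vanishing {f : Plane → ℝ} (hf : SmoothNear f) (h0 : f 0 = 0)
    (hd : fderiv ℝ f 0 ≠ 0) :
    (Ideal.span {toGerm f hf,
      toGerm (lieDeriv XPlus f) (smoothNear_XPlus.lieDeriv hf)} : Ideal SmoothGerms)
        = vanishing := by
  apply le_antisymm
  · rw [Ideal.span_le]
    rintro _ (rfl | rfl)
    · exact h0
    · exact lieDeriv_XPlus_zero f
  · obtain ⟨f₁, f₂, h₁, h₂, hfe⟩ := exists_hadamard hf h0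
    have hder : ∀ p : Plane, ∀ v : Plane,
        fderiv ℝ (fun p : Plane => f₁ p * p.1 + f₂ p * p.2) p v =
          fderiv ℝ f₁ p v * p.1 + f₁ p * v.1 + (fderiv ℝ f₂ p v * p.2 + f₂ p * v.2) := by
      intro p v
      have d₁ := (h₁.differentiable (by simp) p).hasFDerivAt
      have d₂ := (h₂.differentiable (by simp) p).hasFDerivAt
      have d := (d₁.mul (hasFDerivAt_fst (p := p))).add (d₂.mul (hasFDerivAt_snd (p := p)))
      rw [HasFDerivAt.fderiv (f := fun p : Plane => f₁ p * p.1 + f₂ p * p.2) d]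
      simp
      ring
    have hne : f₁ 0 ^ 2 + f₂ 0 ^ 2 ≠ 0 := by
      intro hz
      have ha : f₁ 0 = 0 := by nlinarith [sq_nonneg (f₁ 0), sq_nonneg (f₂ 0)]
      have hb : f₂ 0 = 0 := by nlinarith [sq_nonneg (f₁ 0), sq_nonneg (f₂ 0)]
      apply hd
      ext <;> simp [hfe.fderiv_eq, hder, ha, hb]
    let L := lieDeriv XPlus
    have hL₁ : SmoothNear (L f₁) := smoothNear_XPlus.lieDeriv h₁.smoothNear
    have hL₂ : SmoothNear (L f₂) := smoothNear_XPlus.lieDeriv h₂.smoothNear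
    let x : SmoothGerms := toGerm Prod.fst contDiff_fst.smoothNear
    let y : SmoothGerms := toGerm Prod.snd contDiff_snd.smoothNear
    let F₁ := toGerm f₁ h₁.smoothNear
    let F₂ := toGerm f₂ h₂.smoothNear
    let G₁ := F₂ + toGerm (L f₁) hL₁
    let G₂ := -F₁ + toGerm (L f₂) hL₂
    have e1 : toGerm f hf = F₁ * x + F₂ * y := by
      simp only [F₁, F₂, x, y, toGerm_mul, toGerm_add]
      rwa [toGerm_eq_iff]
    have e2 : toGerm (lieDeriv XPlus f) (smoothNear_XPlus.lieDeriv hf) = G₁ * x + G₂ * y := by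
      simp only [F₁, F₂, G₁, G₂, x, y, toGerm_mul, toGerm_add, toGerm_neg]
      rw [toGerm_eq_iff]
      refine (lieDeriv_congr _ hfe).trans (Eventually.of_forall fun p => ?_)
      simp only [lieDeriv, hder, L]
      simp only [XPlus]
      ring
    have hu : IsUnit (F₁ * G₂ - F₂ * G₁) := by
      apply isUnit_of_evalZero_ne_zero
      simp only [F₁, F₂, G₁, G₂, map_sub, map_mul, map_add, map_neg, evalZero_toGerm, L,
        lieDeriv_XPlus_zero]
      intro hz
      apply hne
      linarith
    obtain ⟨w, hw⟩ := hu.exists_left_inv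
    have hx : x ∈ Ideal.span {toGerm f hf,
        toGerm (lieDeriv XPlus f) (smoothNear_XPlus.lieDeriv hf)} := by
      rw [Ideal.mem_span_pair]
      exact ⟨w * G₂, -(w * F₂), by rw [e1, e2]; linear_combination x * hw⟩
    have hy : y ∈ Ideal.span {toGerm f hf,
        toGerm (lieDeriv XPlus f) (smoothNear_XPlus.lieDeriv hf)} := by
      rw [Ideal.mem_span_pair]
      exact ⟨-(w * G₁), w * F₁, by rw [e1, e2]; linear_combination y * hw⟩
    rw [vanishing_eq_coordIdeal, coordIdeal, Ideal.span_le]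
    rintro _ ⟨j, rfl⟩
    fin_cases j
    · exact hx
    · exact hy

theorem codimPlus_eq_one {f : Plane → ℝ} (hf : SmoothNear f) (h0 : f 0 = 0)
    (hd : fderiv ℝ f 0 ≠ 0) : codimPlus f hf = 1 := by
  have hsurj : Function.Surjective evalZero := fun c => ⟨algebraMap ℝ _ c, by simp⟩
  have e := (Ideal.quotientKerAlgEquivOfSurjective hsurj).toLinearEquiv.rank_eq
  rw [Module.rank_self] at e
  unfold codimPlus codim
  rw [span_eq_vanishing hf h0 hd]
  exact e

end Codimension

/-! ### Rotations of the plane. -/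

section Rotation

/-- The rotation of the plane by the angle `θ`. -/
noncomputable def rot (θ : ℝ) (p : Plane) : Plane :=
  (Real.cos θ * p.1 - Real.sin θ * p.2, Real.sin θ * p.1 + Real.cos θ * p.2)

@[simp] theorem rot_zero_angle (p : Plane) : rot 0 p = p := by simp [rot]

@[simp] theorem rot_zero (θ : ℝ) : rot θ 0 = 0 := by simp [rot]

theorem contDiff_rot : ContDiff ℝ ∞ (fun q : ℝ × Plane => rot q.1 q.2) := by
  unfold rot
  fun_prop

theorem hasDerivAt_rot (θ : ℝ) (p : Plane) :
    HasDerivAt (fun θ => rot θ p) (XPlus (rot θ p)) θ := by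
  have h := (((Real.hasDerivAt_cos θ).mul_const p.1).sub
    ((Real.hasDerivAt_sin θ).mul_const p.2)).prodMk
    (((Real.hasDerivAt_sin θ).mul_const p.1).add ((Real.hasDerivAt_cos θ).mul_const p.2))
  refine h.congr_deriv ?_
  simp only [XPlus, rot, Prod.mk.injEq]
  constructor <;> ring

/-- The norm of `Plane` is the sup norm, which rotations do not preserve; any bound uniform in the
angle is enough. -/
theorem norm_rot_le (θ : ℝ) (p : Plane) : ‖rot θ p‖ ≤ 2 * ‖p‖ := by
  have h1 : |p.1| ≤ ‖p‖ := norm_fst_le p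
  have h2 : |p.2| ≤ ‖p‖ := norm_snd_le p
  have hc : |Real.cos θ * p.1| ≤ ‖p‖ ∧ |Real.cos θ * p.2| ≤ ‖p‖ := by
    simp only [abs_mul]
    constructor <;> nlinarith [Real.abs_cos_le_one θ, abs_nonneg p.1, abs_nonneg p.2]
  have hs : |Real.sin θ * p.1| ≤ ‖p‖ ∧ |Real.sin θ * p.2| ≤ ‖p‖ := by
    simp only [abs_mul]
    constructor <;> nlinarith [Real.abs_sin_le_one θ, abs_nonneg p.1, abs_nonneg p.2]
  refine max_le ?_ ?_
  · exact (abs_sub _ _).trans (by linarith)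
  · exact (abs_add_le _ _).trans (by linarith)

theorem eventually_forall_rot {P : Plane → Prop} (h : ∀ᶠ q in 𝓝 (0 : Plane), P q) :
    ∀ᶠ p in 𝓝 (0 : Plane), ∀ θ, P (rot θ p) := by
  obtain ⟨r, hr, hP⟩ := Metric.eventually_nhds_iff_ball.1 h
  filter_upwards [Metric.ball_mem_nhds (0 : Plane) (half_pos hr)] with p hp θ
  rw [mem_ball_zero_iff] at hp
  refine hP _ (mem_ball_zero_iff.2 ((norm_rot_le θ p).trans_lt (by linarith)))

end Rotation

/-! ### The homotopy method and finite determinacy. -/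

section Homotopy

/-- A smooth function on the line which inverts the numbers close to `1`. -/
theorem exists_contDiff_inverse_near_one :
    ∃ ρ : ℝ → ℝ, ContDiff ℝ ∞ ρ ∧ ∀ x, |x - 1| ≤ 1 / 4 → ρ x * x = 1 := by
  let χ : ContDiffBump (1 : ℝ) := ⟨1 / 4, 1 / 2, by norm_num, by norm_num⟩
  -- Where `χ` is non-zero, `|x - 1| < 1/2`, so the cut-off denominator stays positive. This makes
  -- the later coefficients smooth everywhere, as the differential equation requires.
  have hne : ∀ x, 1 + (x - 1) * χ x ≠ 0 := by
    intro x hx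
    rcases lt_or_ge (dist x 1) (1 / 2) with h | h
    · rw [Real.dist_eq, abs_lt] at h
      have h1 := χ.nonneg (x := x)
      have h2 := χ.le_one (x := x)
      nlinarith
    · rw [χ.zero_of_le_dist h] at hx
      simp at hx
  refine ⟨fun x => (1 + (x - 1) * χ x)⁻¹, ?_, fun x hx => ?_⟩
  · exact (contDiff_const.add ((contDiff_id.sub contDiff_const).mul χ.contDiff)).inv hne
  · have h1 : χ x = 1 := χ.one_of_mem_closedBall (by rwa [Metric.mem_closedBall, Real.dist_eq])
    have h2 := hne x
    change (1 + (x - 1) * χ x)⁻¹ * x = 1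
    rw [h1] at h2 ⊢
    rw [inv_mul_eq_one₀ h2]
    ring

/-- The equation `g = c (f + t g) + u (X f + t X g)` can be solved smoothly in `t ∈ [0, 1]`. -/
theorem exists_homotopy_coefficients {f g α β γ δ : Plane → ℝ}
    (hα : ContDiff ℝ ∞ α) (hβ : ContDiff ℝ ∞ β) (hγ : ContDiff ℝ ∞ γ) (hδ : ContDiff ℝ ∞ δ)
    (hα0 : α 0 = 0) (hβ0 : β 0 = 0) (hδ0 : δ 0 = 0)
    (hg : ∀ᶠ q in 𝓝 (0 : Plane), g q = α q * f q + β q * lieDeriv XPlus f q)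
    (hLg : ∀ᶠ q in 𝓝 (0 : Plane),
      lieDeriv XPlus g q = γ q * f q + δ q * lieDeriv XPlus f q) :
    ∃ c u : ℝ × Plane → ℝ, ContDiff ℝ ∞ c ∧ ContDiff ℝ ∞ u ∧ (∀ t, u (t, 0) = 0) ∧
      ∀ᶠ q in 𝓝 (0 : Plane), ∀ t ∈ Set.Icc (0 : ℝ) 1,
        g q = c (t, q) * (f q + t * g q) +
          u (t, q) * (lieDeriv XPlus f q + t * lieDeriv XPlus g q) := by
  obtain ⟨ρ, hρ, hρ1⟩ := exists_contDiff_inverse_near_one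
  let D : ℝ × Plane → ℝ := fun z =>
    (1 + z.1 * α z.2) * (1 + z.1 * δ z.2) - z.1 ^ 2 * (β z.2 * γ z.2)
  have hD : ContDiff ℝ ∞ D := by
    simp only [D]
    fun_prop
  have hD0 : ∀ t, D (t, 0) = 1 := fun t => by simp [D, hα0, hβ0, hδ0]
  -- `D (t, 0) = 1` for every `t`; compactness of the interval gives one neighbourhood of the origin
  -- valid for all `t`.
  have hDne : ∀ᶠ q in 𝓝 (0 : Plane), ∀ t ∈ Set.Icc (0 : ℝ) 1, ρ (D (t, q)) * D (t, q) = 1 := by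
    refine isCompact_Icc.eventually_forall_of_forall_eventually fun t _ => ?_
    have hc : Tendsto (fun z : Plane × ℝ => D (z.2, z.1)) (𝓝 (0, t)) (𝓝 1) :=
      Continuous.tendsto' (hD.continuous.comp (by fun_prop)) _ _ (hD0 t)
    filter_upwards [hc (Metric.closedBall_mem_nhds (1 : ℝ) (by norm_num : (0 : ℝ) < 1 / 4))]
      with z hz
    exact hρ1 _ hz
  -- Cramer's rule for c(1 + tα) + u tγ = α and c tβ + u(1 + tδ) = β. The determinant is `D`, and
  -- the numerator of u simplifies to β.
  refine ⟨fun z => (α z.2 * (1 + z.1 * δ z.2) - z.1 * (β z.2 * γ z.2)) * ρ (D z),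
    fun z => β z.2 * ρ (D z), by fun_prop, by fun_prop, fun t => by simp [hβ0], ?_⟩
  filter_upwards [hg, hLg, hDne] with q h1 h2 h3 t ht
  have h := h3 t ht
  simp only [D] at h ⊢
  rw [h2, h1]
  linear_combination (-(α q * f q + β q * lieDeriv XPlus f q)) * h

theorem lieDeriv_rot_hasDerivAt {f : Plane → ℝ} (hf : ContDiff ℝ ∞ f) {Y : ℝ → ℝ} {y t : ℝ}
    (hY : HasDerivAt Y y t) (p : Plane) :
    HasDerivAt (fun t => f (rot (Y t) p)) (y * lieDeriv XPlus f (rot (Y t) p)) t := by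
  have h1 := (hasDerivAt_rot (Y t) p).scomp t hY
  have h2 := ((hf.differentiable (by simp) (rot (Y t) p)).hasFDerivAt).comp_hasDerivAt t h1
  refine h2.congr_deriv ?_
  simp [lieDeriv]

/-- The homotopy method: if `g` is infinitesimally tangent to the orbit of `f`, then `f + g` is
equivalent to `f` through a point dependent rotation. -/
theorem exists_rotation_equivalence {f g α β γ δ : Plane → ℝ}
    (hf : ContDiff ℝ ∞ f) (hgs : ContDiff ℝ ∞ g)
    (hα : ContDiff ℝ ∞ α) (hβ : ContDiff ℝ ∞ β) (hγ : ContDiff ℝ ∞ γ) (hδ : ContDiff ℝ ∞ δ)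
    (hα0 : α 0 = 0) (hβ0 : β 0 = 0) (hδ0 : δ 0 = 0)
    (hg : ∀ᶠ q in 𝓝 (0 : Plane), g q = α q * f q + β q * lieDeriv XPlus f q)
    (hLg : ∀ᶠ q in 𝓝 (0 : Plane),
      lieDeriv XPlus g q = γ q * f q + δ q * lieDeriv XPlus f q) :
    ∃ θ h : Plane → ℝ, SmoothNear θ ∧ θ 0 = 0 ∧ IsNonzeroGerm h ∧
      ∀ᶠ p in 𝓝 (0 : Plane), f p = h p * (f (rot (θ p) p) + g (rot (θ p) p)) := by
  obtain ⟨c, u, hc, hu, hu0, hcu⟩ :=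
    exists_homotopy_coefficients hα hβ hγ hδ hα0 hβ0 hδ0 hg hLg
  have hr : ContDiff ℝ ∞ fun z : ℝ × ℝ × Plane => (z.1, rot z.2.1 z.2.2) :=
    contDiff_fst.prodMk (contDiff_rot.comp contDiff_snd)
  -- Along the rotated point, f_t changes at the rate g + Y' L f_t. The choice Y' = -u reduces this
  -- to c f_t, which the exponential factor absorbs.
  let v : ℝ × ℝ × Plane → ℝ := fun z => -u (z.1, rot z.2.1 z.2.2)
  have hv : ContDiff ℝ ∞ v := (hu.comp hr).neg
  let G : ℝ × ℝ × Plane → ℝ := fun z => c (z.1, rot z.2.1 z.2.2)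
  have hG : ContDiff ℝ ∞ G := hc.comp hr
  obtain ⟨Θ, hΘ0, hΘs, hΘ⟩ := exists_smooth_solution v hv (fun t θ => by simp [v, hu0])
  let ζ : Plane → C(unitInterval, ℝ) := fun p =>
    ⟨fun t => G ((t : ℝ), Θ p t, p), hG.continuous.comp (by fun_prop)⟩
  have hζ : ∀ᶠ p in 𝓝 (0 : Plane), ContDiffAt ℝ ∞ ζ p := by
    filter_upwards [hΘs] with p hp
    exact ContDiffAt.comp (f := fun p => (p, Θ p)) p
      (contDiff_superposition_timePath G hG).contDiffAt (contDiffAt_id.prodMk hp)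
  refine ⟨fun p => Θ p 1, fun p => Real.exp (-(primitive (ζ p) 1)), ?_, by simp [hΘ0],
    ⟨?_, Real.exp_ne_zero _⟩, ?_⟩
  · filter_upwards [hΘs] with p hp
    exact ContDiffAt.comp (f := Θ) p
      (ContinuousMap.evalCLM ℝ (1 : unitInterval)).contDiff.contDiffAt hp
  · filter_upwards [hζ] with p hp
    exact (ContDiffAt.comp (f := ζ) p
      (ContinuousMap.evalCLM ℝ (1 : unitInterval) ∘L primitive).contDiff.contDiffAt hp).neg.exp
  · filter_upwards [hΘ, eventually_forall_rot hcu] with p hp hrot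
    let η : C(unitInterval, ℝ) :=
      ⟨fun t => v ((t : ℝ), Θ p t, p), hv.continuous.comp (by fun_prop)⟩
    replace hp : Θ p = primitive η := hp
    let Y : ℝ → ℝ := fun t => ∫ s in (0 : ℝ)..t, Set.IccExtend zero_le_one η s
    let e : ℝ → ℝ := fun t => ∫ s in (0 : ℝ)..t, Set.IccExtend zero_le_one (ζ p) s
    have hY : ∀ t : unitInterval, Y t = Θ p t := fun t => by rw [hp]; rfl
    let F : ℝ → ℝ := fun t => f (rot (Y t) p) + t * g (rot (Y t) p)
    have hder : ∀ t ∈ Set.Icc (0 : ℝ) 1,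
        HasDerivAt (fun t => Real.exp (-(e t)) * F t) 0 t := by
      intro t ht
      have dY : HasDerivAt Y (-u (t, rot (Y t) p)) t := by
        convert hasDerivAt_primitive η t using 1
        rw [Set.IccExtend_of_mem _ _ ht]
        simp only [η, ContinuousMap.coe_mk, v]
        rw [← hY ⟨t, ht⟩]
      have de : HasDerivAt e (c (t, rot (Y t) p)) t := by
        convert hasDerivAt_primitive (ζ p) t using 1
        rw [Set.IccExtend_of_mem _ _ ht]
        simp only [ζ, ContinuousMap.coe_mk, G]
        rw [← hY ⟨t, ht⟩]
      have d := de.neg.exp.mul ((lieDeriv_rot_hasDerivAt hf dY p).add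
        ((hasDerivAt_id t).mul (lieDeriv_rot_hasDerivAt hgs dY p)))
      refine HasDerivAt.congr_deriv (f := fun t => Real.exp (-(e t)) * F t) d ?_
      simp only [id, Pi.add_apply, Pi.mul_apply, Pi.neg_apply]
      linear_combination Real.exp (-e t) * hrot (Y t) t ht
    have hconst := constant_of_has_deriv_right_zero
      (fun t ht => (hder t ht).continuousAt.continuousWithinAt)
      (fun t ht => (hder t ⟨ht.1, ht.2.le⟩).hasDerivWithinAt) 1 (Set.right_mem_Icc.2 zero_le_one)
    have hY1 : Y 1 = Θ p 1 := hY 1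
    have he1 : e 1 = primitive (ζ p) 1 := rfl
    have hY0 : Y 0 = 0 := intervalIntegral.integral_same
    have he0 : e 0 = 0 := intervalIntegral.integral_same
    simp only [F, hY1, he1, hY0, he0] at hconst
    simpa using hconst.symm

end Homotopy

/-- A germ of codimension `k` is determined by its `k`-jet, up to a point dependent rotation and a
non-zero factor. -/
theorem exists_rotation_jet {f : Plane → ℝ} (hf : SmoothNear f) {k : ℕ}
    (hk : codimPlus f hf = k) :
    ∃ θ h : Plane → ℝ, SmoothNear θ ∧ θ 0 = 0 ∧ IsNonzeroGerm h ∧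
      ∀ᶠ p in 𝓝 (0 : Plane), f p = h p * jet k f (rot (θ p) p) := by
  obtain ⟨F, hF, hFf⟩ := hf.exists_contDiff
  have hpow : vanishing ^ k ≤ Ideal.span {toGerm f hf,
      toGerm (lieDeriv XPlus f) (smoothNear_XPlus.lieDeriv hf)} :=
    pow_le_of_rank_quotient_eq vanishing_le_jacobson hk
  rw [← (toGerm_eq_iff hF.smoothNear hf).2 hFf,
    ← (toGerm_eq_iff (smoothNear_XPlus.lieDeriv hF.smoothNear) _).2 (lieDeriv_congr _ hFf)] at hpow
  -- The exponent `k + 1` leaves one factor of the maximal ideal to spare: m^(k+1) = m·m^k ⊆ m·I,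
  -- which is why the coefficients can be chosen to vanish at the origin.
  have hrep : ∀ {g : Plane → ℝ} (hg : SmoothNear g), toGerm g hg ∈ vanishing ^ (k + 1) →
      ∃ α β : Plane → ℝ, ContDiff ℝ ∞ α ∧ ContDiff ℝ ∞ β ∧ α 0 = 0 ∧ β 0 = 0 ∧
        ∀ᶠ q in 𝓝 (0 : Plane), g q = α q * F q + β q * lieDeriv XPlus F q := by
    intro g hg hmem
    rw [pow_succ'] at hmem
    replace hmem := Ideal.mul_mono_right hpow hmem
    rw [Ideal.span_insert, Ideal.mul_sup, Submodule.mem_sup] at hmem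
    obtain ⟨a, ha, b, hb, hab⟩ := hmem
    obtain ⟨a', ha', rfl⟩ := Ideal.mem_mul_span_singleton.1 ha
    obtain ⟨b', hb', rfl⟩ := Ideal.mem_mul_span_singleton.1 hb
    obtain ⟨α, hα, rfl⟩ := exists_contDiff_toGerm a'
    obtain ⟨β, hβ, rfl⟩ := exists_contDiff_toGerm b'
    rw [toGerm_mul, toGerm_mul, toGerm_add, toGerm_eq_iff] at hab
    exact ⟨α, β, hα, hβ, ha', hb', hab.symm⟩
  have hgs := (contDiff_jet k F).sub hF
  obtain ⟨α, β, hα, hβ, hα0, hβ0, hg⟩ := hrep hgs.smoothNear (jet_sub_mem hF k)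
  obtain ⟨γ, δ, hγ, hδ, -, hδ0, hLg⟩ := hrep _
    (toGerm_lieDeriv_mem_pow (k + 1) hgs.smoothNear (jet_sub_mem hF k))
  obtain ⟨θ, h, hθ, hθ0, hh, heq⟩ :=
    exists_rotation_equivalence hF hgs hα hβ hγ hδ hα0 hβ0 hδ0 hg hLg
  refine ⟨θ, h, hθ, hθ0, hh, ?_⟩
  filter_upwards [heq, hFf] with p h1 h2
  rw [← h2, h1, jet_congr k hFf]
  simp

/-! ### Conformal symmetries of the form x dx + y dy. -/

section ConformalSymmetry

/-- The Jacobian determinant of a map of the plane. -/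
noncomputable def jacobian (φ : Plane → Plane) (p : Plane) : ℝ :=
  (fderiv ℝ φ p (1, 0)).1 * (fderiv ℝ φ p (0, 1)).2 -
    (fderiv ℝ φ p (1, 0)).2 * (fderiv ℝ φ p (0, 1)).1

theorem SmoothNear.jacobian {φ : Plane → Plane} (hφ : SmoothNear φ) :
    SmoothNear (jacobian φ) := by
  filter_upwards [hφ] with p hp
  have h : ContDiffAt ℝ ∞ (fderiv ℝ φ) p := hp.fderiv_right (m := ∞) (by simp)
  have h1 : ∀ v : Plane, ContDiffAt ℝ ∞ (fun p => fderiv ℝ φ p v) p :=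
    fun v => h.clm_apply contDiffAt_const
  exact ((h1 (1, 0)).fst.mul (h1 (0, 1)).snd).sub ((h1 (1, 0)).snd.mul (h1 (0, 1)).fst)

theorem clm_apply_eq (A : Plane →L[ℝ] Plane) (v : Plane) :
    A v = v.1 • A (1, 0) + v.2 • A (0, 1) := by
  rw [← map_smul, ← map_smul, ← map_add]
  congr 1
  simp

theorem IsDiffeoGerm.eventually_exists_inverse {φ : Plane → Plane} (hφ : IsDiffeoGerm φ) :
    ∀ᶠ p in 𝓝 (0 : Plane), ∃ B : Plane →L[ℝ] Plane,
      B ∘L fderiv ℝ φ p = ContinuousLinearMap.id ℝ Plane ∧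
      fderiv ℝ φ p ∘L B = ContinuousLinearMap.id ℝ Plane := by
  obtain ⟨h0, hs, ψ, hψ0, hψs, hl, hr⟩ := hφ
  have hc : Tendsto φ (𝓝 0) (𝓝 0) := by
    have := hs.self_of_nhds.continuousAt
    rwa [ContinuousAt, h0] at this
  filter_upwards [hs, hc.eventually hψs, hl.eventually_nhds, hc.eventually hr.eventually_nhds]
    with p h1 h2 h3 h4
  have d1 := (h1.differentiableAt (by simp)).hasFDerivAt
  have d2 := (h2.differentiableAt (by simp)).hasFDerivAt
  refine ⟨fderiv ℝ ψ (φ p), ?_, ?_⟩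
  · exact ((d2.comp p d1).congr_of_eventuallyEq (f₁ := id) (h3.mono fun q hq => hq.symm)).unique
      (hasFDerivAt_id p)
  · have d1' : HasFDerivAt φ (fderiv ℝ φ p) (ψ (φ p)) := by rwa [h3.self_of_nhds]
    exact ((d1'.comp (φ p) d2).congr_of_eventuallyEq (f₁ := id)
      (h4.mono fun q hq => hq.symm)).unique (hasFDerivAt_id (φ p))

theorem jacobian_ne_zero {φ : Plane → Plane} (hφ : IsDiffeoGerm φ) : jacobian φ 0 ≠ 0 := by
  obtain ⟨B, hB, -⟩ := hφ.eventually_exists_inverse.self_of_nhds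
  have h1 := congrArg (fun L => L (1, 0)) hB
  have h2 := congrArg (fun L => L (0, 1)) hB
  simp only [ContinuousLinearMap.comp_apply, ContinuousLinearMap.id_apply] at h1 h2
  rw [clm_apply_eq B] at h1 h2
  simp only [Prod.ext_iff, Prod.fst_add, Prod.snd_add, Prod.smul_fst, Prod.smul_snd,
    smul_eq_mul] at h1 h2
  intro hz
  have : jacobian φ 0 * ((B (1, 0)).1 * (B (0, 1)).2 - (B (1, 0)).2 * (B (0, 1)).1) = 1 := by
    unfold jacobian
    linear_combination ((fderiv ℝ φ 0 (0, 1)).1 * (B (1, 0)).2 +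
      (fderiv ℝ φ 0 (0, 1)).2 * (B (0, 1)).2) * h1.1 + h2.2 -
      ((fderiv ℝ φ 0 (0, 1)).1 * (B (1, 0)).1 +
      (fderiv ℝ φ 0 (0, 1)).2 * (B (0, 1)).1) * h1.2
  rw [hz, zero_mul] at this
  exact zero_ne_one this

/-- A conformal symmetry of `aPlus` rescales the rotation field by a non-zero function. -/
theorem IsConformalSymmetry.exists_scaling {φ : Plane → Plane}
    (hφ : IsConformalSymmetry aPlus φ) :
    ∃ w : Plane → ℝ, IsNonzeroGerm w ∧ ∀ᶠ p in 𝓝 (0 : Plane), ∀ g : Plane → ℝ,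
      g (φ p) • XPlus p = w p • VectorField.pullback ℝ φ (fun p => g p • XPlus p) p := by
  obtain ⟨hd, k, ⟨hk, hk0⟩, hφk⟩ := hφ
  refine ⟨fun p => k p * jacobian φ p, ⟨hk.mul hd.2.1.jacobian,
    mul_ne_zero hk0 (jacobian_ne_zero hd)⟩, ?_⟩
  filter_upwards [hφk, hd.eventually_exists_inverse] with p h1 ⟨B, hB1, hB2⟩ g
  have hinv : (fderiv ℝ φ p).inverse = B := ContinuousLinearMap.inverse_eq hB2 hB1
  rw [VectorField.pullback, hinv, map_smul]
  have hx := congrArg (fun L => L (1, 0)) h1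
  have hy := congrArg (fun L => L (0, 1)) h1
  simp [aPlus, pullbackForm] at hx hy
  -- Let ω be the area form and A the derivative of φ, so a(v) = ω(v, X). Then ω(Av, AX) = det A ·
  -- ω(v, X) = k det A · ω(Av, X∘φ) for all v, and A is invertible.
  have hA : fderiv ℝ φ p (XPlus p) = (k p * jacobian φ p) • XPlus (φ p) := by
    rw [clm_apply_eq]
    simp only [jacobian, XPlus, Prod.ext_iff, Prod.fst_add, Prod.snd_add, Prod.smul_fst,
      Prod.smul_snd, smul_eq_mul]
    constructor
    · rw [hx, hy]; ring
    · rw [hx, hy]; ring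
  have h := congrArg B hA
  rw [← ContinuousLinearMap.comp_apply, hB1, ContinuousLinearMap.id_apply, map_smul] at h
  rw [h, smul_comm]

theorem XPlus_ne_zero {p : Plane} (hp : p ≠ 0) : XPlus p ≠ 0 := by
  contrapose! hp
  simp only [XPlus, Prod.mk_eq_zero, neg_eq_zero] at hp
  exact Prod.ext hp.2 hp.1

/-- Orbital conjugacy of multiples of the rotation field is equivalence of the factors. -/
theorem orbitallyConjugate_iff_kEquivalent {f g : Plane → ℝ} (hf : SmoothNear f)
    (hg : SmoothNear g) :
    OrbitallyConjugate aPlus (fun p => f p • XPlus p) (fun p => g p • XPlus p) ↔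
      KEquivalent aPlus f g := by
  constructor
  · rintro ⟨φ, hφ, h, ⟨hh, hh0⟩, heq⟩
    obtain ⟨w, ⟨hw, hw0⟩, hwφ⟩ := hφ.exists_scaling
    refine ⟨φ, hφ, fun p => h p * (w p)⁻¹, ⟨hh.mul (hw.inv hw0),
      mul_ne_zero hh0 (inv_ne_zero hw0)⟩, ?_⟩
    have hgφ : ContinuousAt (fun p => g (φ p)) 0 :=
      ContinuousAt.comp' (by rw [hφ.1.1]; exact hg.self_of_nhds.continuousAt)
        hφ.1.2.1.self_of_nhds.continuousAt
    -- The field can be cancelled only away from its zero; continuity restores the equality at the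
    -- origin.
    refine (ContinuousAt.eventuallyEq_nhds_iff_eventuallyEq_nhdsNE hf.self_of_nhds.continuousAt
      ((hh.mul (hw.inv hw0)).self_of_nhds.continuousAt.mul hgφ)).1 ?_
    rw [EventuallyEq, eventually_nhdsWithin_iff]
    filter_upwards [heq, hwφ, hw.self_of_nhds.continuousAt.eventually_ne hw0] with p h1 h2 h3 hp
    have h4 : (w p * f p) • XPlus p = (h p * g (φ p)) • XPlus p := by
      rw [mul_smul, mul_smul, h1, h2 g, smul_comm]
    have h5 := smul_left_injective ℝ (XPlus_ne_zero hp) h4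
    change f p = h p * (w p)⁻¹ * g (φ p)
    field_simp
    linarith
  · rintro ⟨φ, hφ, h, ⟨hh, hh0⟩, heq⟩
    obtain ⟨w, ⟨hw, hw0⟩, hwφ⟩ := hφ.exists_scaling
    refine ⟨φ, hφ, fun p => h p * w p, ⟨hh.mul hw, mul_ne_zero hh0 hw0⟩, ?_⟩
    filter_upwards [heq, hwφ] with p h1 h2
    rw [h1, mul_smul, h2 g, mul_smul]

theorem hasFDerivAt_sq_add_sq (q : Plane) :
    HasFDerivAt (fun q : Plane => q.1 ^ 2 + q.2 ^ 2) ((2 : ℝ) • aPlus q) q := by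
  refine (((hasFDerivAt_fst (p := q)).pow 2).add
    ((hasFDerivAt_snd (p := q)).pow 2)).congr_fderiv ?_
  ext <;> simp [aPlus]

/-- The rotation by `θ` as a continuous linear equivalence. -/
noncomputable def rotEquiv (θ : ℝ) : Plane ≃L[ℝ] Plane :=
  ContinuousLinearEquiv.equivOfInverse
    ((Real.cos θ • ContinuousLinearMap.fst ℝ ℝ ℝ - Real.sin θ • ContinuousLinearMap.snd ℝ ℝ ℝ).prod
      (Real.sin θ • ContinuousLinearMap.fst ℝ ℝ ℝ + Real.cos θ • ContinuousLinearMap.snd ℝ ℝ ℝ))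
    ((Real.cos θ • ContinuousLinearMap.fst ℝ ℝ ℝ + Real.sin θ • ContinuousLinearMap.snd ℝ ℝ ℝ).prod
      (Real.cos θ • ContinuousLinearMap.snd ℝ ℝ ℝ - Real.sin θ • ContinuousLinearMap.fst ℝ ℝ ℝ))
    (fun p => by
      have h := Real.sin_sq_add_cos_sq θ
      ext
      · simp; linear_combination p.1 * h
      · simp; linear_combination p.2 * h)
    (fun p => by
      have h := Real.sin_sq_add_cos_sq θ
      ext
      · simp; linear_combination p.1 * h
      · simp; linear_combination p.2 * h)

/-- A point dependent rotation is a conformal symmetry of `aPlus`. -/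
theorem isConformalSymmetry_rot {θ : Plane → ℝ} (hθ : SmoothNear θ) :
    IsConformalSymmetry aPlus (fun p => rot (θ p) p) := by
  have hs : SmoothNear (fun p => rot (θ p) p) := by
    filter_upwards [hθ] with p hp
    exact ContDiffAt.comp (f := fun p => (θ p, p)) p contDiff_rot.contDiffAt
      (hp.prodMk contDiffAt_id)
  -- The terms containing the derivative of `θ` carry a coordinate as a factor, so they vanish at
  -- the origin.
  have hder : HasFDerivAt (fun p => rot (θ p) p) (rotEquiv (θ 0) : Plane →L[ℝ] Plane) 0 := by
    have d := (hθ.self_of_nhds.differentiableAt (by simp)).hasFDerivAt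
    have h := ((d.cos.mul (hasFDerivAt_fst (p := (0 : Plane)))).sub
      (d.sin.mul (hasFDerivAt_snd (p := (0 : Plane))))).prodMk
      ((d.sin.mul (hasFDerivAt_fst (p := (0 : Plane)))).add
      (d.cos.mul (hasFDerivAt_snd (p := (0 : Plane)))))
    refine HasFDerivAt.congr_fderiv (f := fun p => rot (θ p) p) h ?_
    refine ContinuousLinearMap.ext fun v => ?_
    simp [rotEquiv]
  obtain ⟨ψ, hψ0, hψs, hl, hr⟩ := exists_smooth_localInverse hs _ hder
  simp only [rot_zero] at hψ0 hψs hr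
  refine ⟨⟨rot_zero _, hs, ψ, hψ0, hψs, hl, hr⟩, fun _ => 1,
    ⟨contDiff_const.smoothNear, one_ne_zero⟩, ?_⟩
  filter_upwards [hs] with p hp
  have h1 := HasFDerivAt.comp (f := fun p => rot (θ p) p) p (hasFDerivAt_sq_add_sq (rot (θ p) p)) (hp.differentiableAt (by simp)).hasFDerivAt
  -- Differentiating the invariance of x² + y² gives φ^*a = a, so the conformal factor is 1.
  have h2 : ((fun q : Plane => q.1 ^ 2 + q.2 ^ 2) ∘ fun p => rot (θ p) p) =
      fun q : Plane => q.1 ^ 2 + q.2 ^ 2 := by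
    ext q
    simp only [Function.comp_apply, rot]
    linear_combination (q.1 ^ 2 + q.2 ^ 2) * Real.sin_sq_add_cos_sq (θ q)
  rw [h2] at h1
  have h3 := (hasFDerivAt_sq_add_sq p).unique h1
  rw [ContinuousLinearMap.smul_comp] at h3
  rw [one_smul]
  exact smul_right_injective _ (two_ne_zero (α := ℝ)) h3

end ConformalSymmetry

/-! ### Normal forms and invariance of the codimension on their classes. -/

section NormalForms

theorem kEquivalent_jet {f : Plane → ℝ} (hf : SmoothNear f) {k : ℕ} (hk : codimPlus f hf = k) :
    KEquivalent aPlus f (jet k f) := by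
  obtain ⟨θ, h, hθ, -, hh, heq⟩ := exists_rotation_jet hf hk
  exact ⟨_, isConformalSymmetry_rot hθ, h, hh, heq⟩

theorem kEquivalent_one {f : Plane → ℝ} (hf : SmoothNear f) (h0 : f 0 ≠ 0) :
    KEquivalent aPlus f fun _ => 1 :=
  ⟨_, isConformalSymmetry_rot (θ := fun _ => 0) contDiff_const.smoothNear, f, ⟨hf, h0⟩,
    Eventually.of_forall fun _ => (mul_one _).symm⟩

theorem jet_one (f : Plane → ℝ) (p : Plane) : jet 1 f p = f 0 + fderiv ℝ f 0 p := by
  simp [jet, Finset.sum_range_succ, iteratedFDeriv_one_apply]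

theorem kEquivalent_fst {f : Plane → ℝ} (hf : SmoothNear f) (h0 : f 0 = 0)
    (hd : fderiv ℝ f 0 ≠ 0) : KEquivalent aPlus f Prod.fst := by
  obtain ⟨θ, h, hθ, -, hh, heq⟩ := exists_rotation_jet hf (k := 1)
    (by rw [codimPlus_eq_one hf h0 hd, Nat.cast_one])
  -- For the linear part ax + by, take z = a - ib: then ax + by = ‖z‖(x cos(arg z) - y sin(arg z)),
  -- which is ‖z‖ times the first coordinate after rotation by arg z.
  let z : ℂ := ⟨fderiv ℝ f 0 (1, 0), -fderiv ℝ f 0 (0, 1)⟩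
  have ha : ‖z‖ * Real.cos z.arg = fderiv ℝ f 0 (1, 0) := Complex.norm_mul_cos_arg z
  have hb : ‖z‖ * Real.sin z.arg = -fderiv ℝ f 0 (0, 1) := Complex.norm_mul_sin_arg z
  have hz : ‖z‖ ≠ 0 := by
    intro hz
    rw [hz, zero_mul] at ha hb
    apply hd
    ext <;> simp <;> linarith
  refine ⟨_, isConformalSymmetry_rot (θ := fun p => θ p + z.arg)
    (hθ.add contDiff_const.smoothNear), fun p => h p * ‖z‖,
    ⟨hh.1.mul contDiff_const.smoothNear, mul_ne_zero hh.2 hz⟩, ?_⟩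
  filter_upwards [heq] with p hp
  have hlin : ∀ v : Plane, fderiv ℝ f 0 v =
      v.1 * fderiv ℝ f 0 (1, 0) + v.2 * fderiv ℝ f 0 (0, 1) := by
    intro v
    rw [← smul_eq_mul, ← smul_eq_mul, ← map_smul, ← map_smul, ← map_add]
    congr 1
    simp
  rw [hp, jet_one, h0, zero_add, hlin, ← ha,
    show fderiv ℝ f 0 (0, 1) = -(‖z‖ * Real.sin z.arg) by linarith]
  simp only [rot, Real.cos_add, Real.sin_add]
  ring

theorem ne_zero_of_kEquivalent_one {f : Plane → ℝ} (h : KEquivalent aPlus f fun _ => 1) :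
    f 0 ≠ 0 := by
  obtain ⟨φ, -, h, hh, heq⟩ := h
  rw [heq.self_of_nhds, mul_one]
  exact hh.2

/-- At the origin df = h(0) dφ₁, which is non-zero on the preimage of (1, 0) under dφ. Hence every
multiple of the rotation field in the class of `x · XPlus` has codimension 1. -/
theorem regular_of_kEquivalent_fst {f : Plane → ℝ} (h : KEquivalent aPlus f Prod.fst) :
    f 0 = 0 ∧ fderiv ℝ f 0 ≠ 0 := by
  obtain ⟨φ, hφ, h, hh, heq⟩ := h
  refine ⟨by rw [heq.self_of_nhds, hφ.1.1]; simp, fun hz => ?_⟩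
  obtain ⟨B, -, hB⟩ := hφ.1.eventually_exists_inverse.self_of_nhds
  have d1 := (hφ.1.2.1.self_of_nhds.differentiableAt (by simp)).hasFDerivAt
  have d2 := (hh.1.self_of_nhds.differentiableAt (by simp)).hasFDerivAt
  have d := d2.mul d1.fst
  have e := (d.congr_of_eventuallyEq heq).fderiv
  rw [hz] at e
  have e1 := congrArg (fun L => L (B (1, 0))) e
  have hB1 := congrArg (fun L => L (1, 0)) hB
  simp only [ContinuousLinearMap.comp_apply, ContinuousLinearMap.id_apply] at hB1
  simp [hφ.1.1, hB1] at e1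
  exact hh.2 e1.symm

/-- A curve with the property of zeros does not reduce to the origin. -/
theorem ne_zero_of_propertyOfZeros {f : Plane → ℝ} (hf : SmoothNear f) (hz : PropertyOfZeros f)
    (hone : ∀ᶠ p in 𝓝 (0 : Plane), f p = 0 → p = 0) : f 0 ≠ 0 := by
  intro h0
  -- If f vanishes only at the origin, then x vanishes on its zero set, so x = q f. Differentiating
  -- at 0, where f = 0, gives dx = q(0) df and thus df ≠ 0.
  obtain ⟨q, hq, hfq⟩ := hz Prod.fst contDiff_fst.smoothNear
    (hone.mono fun p hp hfp => by rw [hp hfp]; rfl)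
  have hd : fderiv ℝ f 0 ≠ 0 := by
    intro hd
    have d1 := (hf.self_of_nhds.differentiableAt (by simp)).hasFDerivAt
    have d2 := (hq.self_of_nhds.differentiableAt (by simp)).hasFDerivAt
    have e := ((d2.mul d1).congr_of_eventuallyEq hfq).unique (hasFDerivAt_fst (p := (0 : Plane)))
    have e1 := congrArg (fun L => L (1, 0)) e
    simp [hd, h0] at e1
  obtain ⟨φ, ⟨⟨hφ0, -, ψ, hψ0, hψs, -, hr⟩, -⟩, h, -, heq⟩ := kEquivalent_fst hf h0 hd
  have hψ : Tendsto ψ (𝓝 0) (𝓝 0) := by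
    have := hψs.self_of_nhds.continuousAt
    rwa [ContinuousAt, hψ0] at this
  have hι : Tendsto (fun t : ℝ => ((0, t) : Plane)) (𝓝 0) (𝓝 0) :=
    Continuous.tendsto' (by fun_prop) _ _ rfl
  -- The inverse symmetry carries the y-axis into the zeros of f, so every small point of that axis
  -- would be the origin.
  have hev : ∀ᶠ t in 𝓝 (0 : ℝ), t = 0 := by
    filter_upwards [hι.eventually hr, hι.eventually (hψ.eventually heq),
      hι.eventually (hψ.eventually hone)] with t h1 h2 h3
    rw [h1, mul_zero] at h2
    rw [h3 h2, hφ0] at h1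
    exact (congrArg Prod.snd h1).symm
  have := (hev.filter_mono nhdsWithin_le_nhds).and (self_mem_nhdsWithin (s := {(0 : ℝ)}ᶜ))
  obtain ⟨t, ht, ht'⟩ := this.exists
  exact ht' ht

end NormalForms

end PlanarGerm

theorem mainTheorem8 (f : Plane → ℝ) (hf : SmoothNear f) :
    -- `x² + y²` is a first integral of `X = f · X_{a₂⁺}`
    (∀ᶠ p in 𝓝 (0 : Plane),
      lieDeriv (fun p => f p • XPlus p) (fun p => p.1 ^ 2 + p.2 ^ 2) p = 0) ∧
    -- (1) `X` has only one zero
    (PropertyOfZeros f →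
      (∀ᶠ p in 𝓝 (0 : Plane), f p • XPlus p = 0 ↔ p = 0) →
        OrbitallyConjugate aPlus
          (fun p => f p • XPlus p) XPlus ∧
        codimPlus f hf = 0) ∧
    (∀ (g : Plane → ℝ) (hg : SmoothNear g),
      OrbitallyConjugate aPlus
          (fun p => g p • XPlus p) XPlus →
        codimPlus g hg = 0) ∧
    -- (2) the curve `{f = 0}` passes through the origin and is regular there
    (f 0 = 0 → fderiv ℝ f 0 ≠ 0 →
      codimPlus f hf = 1 ∧
      OrbitallyConjugate aPlus
        (fun p => f p • XPlus p) (fun p => (-(p.1 * p.2), p.1 ^ 2))) ∧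
    (∀ (g : Plane → ℝ) (hg : SmoothNear g),
      OrbitallyConjugate aPlus
          (fun p => g p • XPlus p) (fun p => (-(p.1 * p.2), p.1 ^ 2)) →
        codimPlus g hg = 1) ∧
    -- (3) `f` has finite codimension `k`
    (∀ k : ℕ, codimPlus f hf = k →
      KEquivalent aPlus f (jet k f) ∧
      OrbitallyConjugate aPlus
        (fun p => f p • XPlus p)
        (fun p => jet k f p • XPlus p)) := by
  -- Both model fields are written as multiples of `XPlus`, with factors 1 and x, so that the
  -- reduction to function germs applies.
  have hX : XPlus = fun p => (1 : ℝ) • XPlus p := by simp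
  have hxX : (fun p : Plane => ((-(p.1 * p.2), p.1 ^ 2) : Plane)) = fun p => p.1 • XPlus p := by
    ext p <;> simp [XPlus, sq]
  have hfst : SmoothNear (Prod.fst : Plane → ℝ) := contDiff_fst.smoothNear
  have hone : SmoothNear (fun _ : Plane => (1 : ℝ)) := contDiff_const.smoothNear
  have iff_one : ∀ {g : Plane → ℝ}, SmoothNear g →
      (OrbitallyConjugate aPlus (fun p => g p • XPlus p) XPlus ↔
        KEquivalent aPlus g fun _ => 1) := fun {g} hg => by
    conv_lhs => rw [hX]
    simpa using orbitallyConjugate_iff_kEquivalent hg hone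
  have iff_fst : ∀ {g : Plane → ℝ}, SmoothNear g →
      (OrbitallyConjugate aPlus (fun p => g p • XPlus p) (fun p => (-(p.1 * p.2), p.1 ^ 2)) ↔
        KEquivalent aPlus g Prod.fst) := fun {g} hg => by
    rw [hxX]
    exact orbitallyConjugate_iff_kEquivalent hg hfst
  refine ⟨Eventually.of_forall fun p => ?_, fun hz hzero => ?_, fun g hg h => ?_,
    fun h0 hd => ?_, fun g hg h => ?_, fun k hk => ?_⟩
  · rw [lieDeriv, (hasFDerivAt_sq_add_sq p).fderiv]
    simp [aPlus, XPlus]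
    ring
  · have h0 : f 0 ≠ 0 := ne_zero_of_propertyOfZeros hf hz
      (hzero.mono fun p hp hfp => hp.1 (by rw [hfp, zero_smul]))
    exact ⟨(iff_one hf).2 (kEquivalent_one hf h0), codimPlus_eq_zero hf h0⟩
  · exact codimPlus_eq_zero hg (ne_zero_of_kEquivalent_one ((iff_one hg).1 h))
  · exact ⟨codimPlus_eq_one hf h0 hd, (iff_fst hf).2 (kEquivalent_fst hf h0 hd)⟩
  · obtain ⟨h0, hd⟩ := regular_of_kEquivalent_fst ((iff_fst hg).1 h)
    exact codimPlus_eq_one hg h0 hd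
  · have h := kEquivalent_jet hf hk
    exact ⟨h, (orbitallyConjugate_iff_kEquivalent hf (contDiff_jet k f).smoothNear).2 h⟩
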